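/- All graphs are finite, simple, undirected and connected. For vertices $u,v$ of a graph $G=(V,E)$ let $I_m(u,v)$ be the set of all vertices lying on induced $(u,v)$-paths of $G$. A set $S\subseteq V$ is m-convex if $I_m(u,v)\subseteq S$ for all $u,v\in S$, and $H\subseteq V$ is a monophonic halfspace if both $H$ and $V\setminus H$ are m-convex (so $\varnothing$ and $V$ are monophonic halfspaces). Let $\mathcal H_m(G)$ be the set of all monophonic halfspaces of $G$, let $n=|V|$ and $m=|E|$, and let $d$ be the VC-dimension of $\mathcal H_m(G)$, that is, the maximum size of a set $S\subseteq V$ with $\{H\cap S: H\in\mathcal H_m(G)\}=2^S$. (1) Every such graph $G$ satisfies $|\mathcal H_m(G)|\le m\,2^d+2$. (2) There are a deterministic algorithm and a polynomial $p$ such that, for every such graph $G$ on the vertex set $\{0,\dots,n-1\}$, given by its adjacency matrix, the algorithm outputs a list containing each member of $\mathcal H_m(G)$ exactly once and halts after at most $|\mathcal H_m(G)|\cdot p(n)$ steps and also after at most $2^d\,p(n)$ steps. In particular, $\mathcal H_m(G)$ can be enumerated in time $2^d\,\mathrm{poly}(n)$. (Algorithms are WHILE-programs over binary trees, in which each elementary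 operation `nil', `cons', `head', `tail', assignment, or test for `nil' is one step.) -/

import Mathlib

namespace MonoHalf

/-! ### Monophonic halfspaces -/

section Graph

universe u

/-- The monophonic interval `I_m(u, v)`: all vertices lying on induced (that is, chordless)
`(u, v)`-paths of `G`. -/
def mInterval {V : Type u} (G : SimpleGraph V) (u v : V) : Set V :=
  {w | ∃ p : G.Walk u v, p.IsPath ∧ p.IsChordless ∧ w ∈ p.support}

/-- `S` is monophonically convex: it contains the monophonic interval of any two of its
elements. -/
def IsMConvex {V : Type u} (G : SimpleGraph V) (S : Set V) : Prop :=
  ∀ u ∈ S, ∀ v ∈ S, mInterval G u v ⊆ S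

/-- `H` is a monophonic halfspace: `H` and its complement are both monophonically convex
(`∅` and the whole vertex set are halfspaces). -/
def IsMHalfspace {V : Type u} (G : SimpleGraph V) (H : Set V) : Prop :=
  IsMConvex G H ∧ IsMConvex G Hᶜ

open Classical in
/-- `H_m(G)`, the family of all monophonic halfspaces of a finite graph `G`. -/
noncomputable def mHalfspaces {V : Type u} [Fintype V] (G : SimpleGraph V) :
    Finset (Finset V) :=
  Finset.univ.filter fun H => IsMHalfspace G (H : Set V)

end Graph

/-! ### The machine model

Jones's `WHILE` language: imperative programs whose variables hold binary trees. Each elementary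
operation (reading a variable, forming `nil`, `cons`, `hd`, `tl`, an assignment, a branch on
whether a value is `nil`) is one step; each of them is a constant-time operation on a pointer
machine or a RAM. -/

/-- The data values: binary trees without labels. -/
inductive Data : Type where
  | nil : Data
  | cons : Data → Data → Data

/-- The left subtree; the left subtree of `nil` is `nil`. -/
def Data.hd : Data → Data
  | .nil => .nil
  | .cons x _ => x

/-- The right subtree; the right subtree of `nil` is `nil`. -/
def Data.tl : Data → Data
  | .nil => .nil
  | .cons _ y => y

/-- Expressions over the variables `X₀, X₁, X₂, …`. -/
inductive Expr : Type where
  | var : ℕ → Expr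
  | nil : Expr
  | cons : Expr → Expr → Expr
  | hd : Expr → Expr
  | tl : Expr → Expr

/-- The contents of all variables. -/
abbrev Store : Type := ℕ → Data

/-- The value of an expression. -/
def Expr.val (s : Store) : Expr → Data
  | .var i => s i
  | .nil => .nil
  | .cons e f => .cons (e.val s) (f.val s)
  | .hd e => (e.val s).hd
  | .tl e => (e.val s).tl

/-- The number of steps it takes to evaluate an expression: the number of its nodes. -/
def Expr.cost : Expr → ℕ
  | .var _ => 1
  | .nil => 1
  | .cons e f => e.cost + f.cost + 1
  | .hd e => e.cost + 1
  | .tl e => e.cost + 1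

/-- Programs. -/
inductive Program : Type where
  | assign : ℕ → Expr → Program
  | seq : Program → Program → Program
  | ite : Expr → Program → Program → Program
  | loop : Expr → Program → Program

/-- `Exec c s t s'`: started in the store `s`, the program `c` halts after exactly `t` steps in
the store `s'`. `Program.loop e c` is `while e do c`; a test succeeds if the value of the tested
expression is not `nil`. -/
inductive Exec : Program → Store → ℕ → Store → Prop where
  | assign (i : ℕ) (e : Expr) (s : Store) :
      Exec (.assign i e) s (e.cost + 1) (Function.update s i (e.val s))
  | seq {c₁ c₂ : Program} {s s₁ s₂ : Store} {t₁ t₂ : ℕ} :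
      Exec c₁ s t₁ s₁ → Exec c₂ s₁ t₂ s₂ → Exec (.seq c₁ c₂) s (t₁ + t₂) s₂
  | ite_true {e : Expr} {c₁ c₂ : Program} {s s' : Store} {t : ℕ} :
      e.val s ≠ .nil → Exec c₁ s t s' → Exec (.ite e c₁ c₂) s (e.cost + 1 + t) s'
  | ite_false {e : Expr} {c₁ c₂ : Program} {s s' : Store} {t : ℕ} :
      e.val s = .nil → Exec c₂ s t s' → Exec (.ite e c₁ c₂) s (e.cost + 1 + t) s'
  | loop_true {e : Expr} {c : Program} {s s₁ s₂ : Store} {t₁ t₂ : ℕ} :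
      e.val s ≠ .nil → Exec c s t₁ s₁ → Exec (.loop e c) s₁ t₂ s₂ →
        Exec (.loop e c) s (e.cost + 1 + t₁ + t₂) s₂
  | loop_false {e : Expr} {c : Program} {s : Store} :
      e.val s = .nil → Exec (.loop e c) s (e.cost + 1) s

/-- On input `x` (in the variable `X₀`, all other variables being `nil`) the program `c` halts
after exactly `t` steps with output `y` (in the variable `X₀`). -/
def Computes (c : Program) (x : Data) (t : ℕ) (y : Data) : Prop :=
  ∃ s : Store, Exec c (Function.update (fun _ => Data.nil) 0 x) t s ∧ s 0 = y

/-! ### Input and output formats -/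

/-- A truth value as a tree. -/
def Data.ofBool : Bool → Data
  | false => .nil
  | true => .cons .nil .nil

/-- A list of trees as a tree. -/
def Data.ofList : List Data → Data
  | [] => .nil
  | x :: l => .cons x (Data.ofList l)

open Classical in
/-- A set of vertices, given by its characteristic vector. -/
noncomputable def encodeSet {n : ℕ} (H : Finset (Fin n)) : Data :=
  Data.ofList (List.ofFn fun i => Data.ofBool (decide (i ∈ H)))

open Classical in
/-- A graph, given by its adjacency matrix (the list of its rows). -/
noncomputable def encodeGraph {n : ℕ} (G : SimpleGraph (Fin n)) : Data :=
  Data.ofList (List.ofFn fun i =>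
    Data.ofList (List.ofFn fun j => Data.ofBool (decide (G.Adj i j))))

/-- `c` lists, on input `G`, every member of `H_m(G)` exactly once and halts after `t` steps. -/
def Enumerates (c : Program) {n : ℕ} (G : SimpleGraph (Fin n)) (t : ℕ) : Prop :=
  ∃ L : List (Finset (Fin n)), L.Nodup ∧ (∀ H, H ∈ L ↔ H ∈ mHalfspaces G) ∧
    Computes c (encodeGraph G) t (Data.ofList (L.map encodeSet))

end MonoHalf

/-!
# Counting and enumerating monophonic halfspaces

*Local description.* In a connected graph a set `H` is a halfspace if and only if the vertices of
`H` with a neighbour outside `H` form a clique, and likewise for the complement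
(`isMHalfspace_iff`): a shortest path through the other side between two nonadjacent boundary
vertices would be induced, and an induced path leaving `H` and coming back has nonadjacent boundary
vertices.

*Counting.* Call an edge `ab` cut by `H`, with `a ∈ H`, tight for `H` if it is locally optimal with
respect to the number of cut edges at `a` and at `b`. Each halfspace other than `∅` and the whole
vertex set has a tight edge (`exists_tight`). The halfspaces with a given tight edge `ab` are given
by a system of two-clauses. In general such a system contains proper implications `v ∈ H → u ∈ H`
between common neighbours of `a` and `b`, but tightness makes each of them collapse: one of the two
memberships is constant (`IsSum.notMem_of_notMem`). What remains are equations over the field with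
two elements, so the family is closed under sums of three members (`IsSum.tight`). An affine family
of size `2 ^ k` shatters a set of size `k`; complements of members are halfspaces as well, which
adds the vertex `a` to the shattered set. Hence every ordered edge accounts for at most
`2 ^ (d - 1)` halfspaces (`two_mul_card_tightHalfspaces_le`), and there are twice as many ordered
edges as edges.

*Enumeration.* The halfspaces that contain `a` and avoid `b`, for an edge `ab`, are the solutions of
a system of two-clauses (`clash_eq_false_iff`), for which unit propagation decides whether a
partial assignment extends to a solution (`satisfiable_iff`). Hence a polynomial-time test tells
whether a partial characteristic vector extends to a halfspace (`extendable_iff`). Extending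
vectors bit by bit and keeping the extendable ones, the algorithm never has more vectors than there
are halfspaces, so it takes polynomial time per halfspace; the second time bound follows from the
first one and the counting bound.

*Programs.* `PolyTime f` says that some program computes `f` with polynomial bounds on the time and
on the size of the result. It is closed under composition, pairing, case distinction and iteration
over a list with small intermediate results, which is all that the extendability test needs. A
subprogram is called on renamed, odd variables, so that it leaves the even ones alone.
-/

namespace MonoHalf

/-! ### Halfspaces and boundary cliques -/

section Boundary

universe u

variable {V : Type u} {G : SimpleGraph V}

/-- The vertices of `H` that have a neighbour outside `H` are pairwise adjacent. -/
def BoundaryClique (G : SimpleGraph V) (H : Set V) : Prop :=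
  ∀ ⦃x x' y y'⦄, x ∈ H → x' ∈ H → y ∉ H → y' ∉ H → G.Adj x y → G.Adj x' y' →
    x ≠ x' → G.Adj x x'

lemma isChordless_of_length_eq_dist {u v : V} {p : G.Walk u v} (hp : p.length = G.dist u v) :
    p.IsChordless := by
  have key : ∀ i j, i < j → j ≤ p.length → G.Adj (p.getVert i) (p.getVert j) → j = i + 1 := by
    intro i j hij hj hadj
    have h1 := SimpleGraph.dist_le ((p.take i).append (.cons hadj (p.drop j)))
    rw [SimpleGraph.Walk.length_append, SimpleGraph.Walk.length_cons,
      SimpleGraph.Walk.take_length, SimpleGraph.Walk.drop_length] at h1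
    omega
  rw [SimpleGraph.Walk.isChordless_iff_forall_mem_edges]
  intro x y hx hy hxy
  obtain ⟨i, rfl, hi⟩ := SimpleGraph.Walk.mem_support_iff_exists_getVert.1 hx
  obtain ⟨j, rfl, hj⟩ := SimpleGraph.Walk.mem_support_iff_exists_getVert.1 hy
  have edge : ∀ i, i < p.length → s(p.getVert i, p.getVert (i + 1)) ∈ p.edges := by
    intro i hi
    rw [SimpleGraph.Walk.mk_mem_edges_iff_exists]
    exact ⟨i, hi, rfl⟩
  rcases lt_trichotomy i j with h | h | h
  · obtain rfl := key i j h hj hxy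
    exact edge i (by omega)
  · subst h
    exact absurd hxy (G.loopless.irrefl _)
  · obtain rfl := key j i h hi hxy.symm
    rw [Sym2.eq_swap]
    exact edge j (by omega)

/-- A shortest path of the subgraph induced on `S` is an induced path of the whole graph. -/
lemma exists_isChordless_of_reachable_induce {S : Set V} {x y : S}
    (h : (G.induce S).Reachable x y) :
    ∃ p : G.Walk x y, p.IsPath ∧ p.IsChordless ∧ ∀ w ∈ p.support, w ∈ S := by
  obtain ⟨p, hp, hl⟩ := h.exists_path_of_dist
  have hc := isChordless_of_length_eq_dist hl
  rw [SimpleGraph.Walk.isChordless_iff_forall_mem_edges] at hc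
  suffices ∃ p : G.Walk ((SimpleGraph.Embedding.induce (G := G) S).toHom x)
      ((SimpleGraph.Embedding.induce (G := G) S).toHom y),
      p.IsPath ∧ p.IsChordless ∧ ∀ w ∈ p.support, w ∈ S from this
  refine ⟨p.map (SimpleGraph.Embedding.induce S).toHom, ?_, ?_, ?_⟩
  · exact hp.map Subtype.val_injective
  · rw [SimpleGraph.Walk.isChordless_iff_forall_mem_edges]
    intro u v hu hv huv
    rw [SimpleGraph.Walk.support_map, List.mem_map] at hu hv
    obtain ⟨u, hu, rfl⟩ := hu
    obtain ⟨v, hv, rfl⟩ := hv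
    rw [SimpleGraph.Walk.edges_map, List.mem_map]
    exact ⟨_, hc hu hv huv, rfl⟩
  · intro w hw
    rw [SimpleGraph.Walk.support_map, List.mem_map] at hw
    obtain ⟨w, -, rfl⟩ := hw
    exact w.2

/-- A shortest path of the graph between two points of a convex set stays in the set. -/
lemma IsMConvex.reachable_induce (hG : G.Connected) {S : Set V} (hS : IsMConvex G S) (x y : S) :
    (G.induce S).Reachable x y := by
  obtain ⟨p, hp, hl⟩ := hG.exists_path_of_dist x.1 y.1
  exact ⟨p.induce S fun w hw => hS x x.2 y y.2 ⟨p, hp, isChordless_of_length_eq_dist hl, hw⟩⟩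

lemma IsMConvex.boundaryClique (hG : G.Connected) {H : Set V} (hH : IsMConvex G H)
    (hHc : IsMConvex G Hᶜ) : BoundaryClique G H := by
  intro x x' y y' hx hx' hy hy' hxy hxy' hne
  by_contra hadj
  -- an induced path from `x` to `x'` whose inner vertices avoid `H`
  have hS : (G.induce (Hᶜ ∪ {x, x'})).Reachable ⟨x, by simp⟩ ⟨x', by simp⟩ := by
    have h1 := (hHc.reachable_induce hG ⟨y, hy⟩ ⟨y', hy'⟩).map
      (SimpleGraph.induceHomOfLE G (Set.subset_union_left : Hᶜ ⊆ Hᶜ ∪ {x, x'})).toHom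
    have h2 : (G.induce (Hᶜ ∪ {x, x'})).Reachable ⟨x, by simp⟩ ⟨y, Or.inl hy⟩ :=
      SimpleGraph.Adj.reachable (by simpa using hxy)
    have h3 : (G.induce (Hᶜ ∪ {x, x'})).Reachable ⟨y', Or.inl hy'⟩ ⟨x', by simp⟩ :=
      SimpleGraph.Adj.reachable (by simpa using hxy'.symm)
    exact (h2.trans h1).trans h3
  obtain ⟨p, hp, hc, hs⟩ := exists_isChordless_of_reachable_induce hS
  cases p with
  | nil => exact hne rfl
  | @cons _ z _ h q =>
    have hz : z ∈ (SimpleGraph.Walk.cons h q).support := by simp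
    rcases hs z hz with hz' | rfl | rfl
    · exact hz' (hH x hx x' hx' ⟨_, hp, hc, hz⟩)
    · exact h.ne rfl
    · exact hadj h

/-- The vertices at which an induced path leaves `H` for `w ∉ H` and comes back are distinct and not
consecutive on the path, so they are nonadjacent. -/
lemma BoundaryClique.isMConvex {H : Set V} (hH : BoundaryClique G H) : IsMConvex G H := by
  classical
  rintro u hu v hv w ⟨p, hp, hc, hw⟩
  by_contra hwH
  obtain ⟨d, hd, hd1, hd2⟩ := (p.takeUntil w hw).exists_boundary_dart H hu hwH
  obtain ⟨e, he, he1, he2⟩ := (p.dropUntil w hw).exists_boundary_dart Hᶜ hwH (by simpa using hv)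
  have he2 : e.snd ∈ H := by simpa using he2
  have hd1s := (p.takeUntil w hw).dart_fst_mem_support_of_mem_darts hd
  have he2s := (p.dropUntil w hw).dart_snd_mem_support_of_mem_darts he
  have hmeet : ∀ z ∈ (p.takeUntil w hw).support, z ∈ (p.dropUntil w hw).support → z = w := by
    intro z h1 h2
    have hn := hp.support_nodup
    rw [← p.take_spec hw, SimpleGraph.Walk.support_append, List.nodup_append] at hn
    rw [SimpleGraph.Walk.mem_support_iff] at h2
    rcases h2 with h2 | h2
    · exact h2
    · exact absurd rfl (hn.2.2 z h1 z h2)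
  have hne : d.fst ≠ e.snd := by
    intro h
    have := hmeet _ hd1s (h ▸ he2s)
    exact hwH (this ▸ hd1)
  have hadj := hH hd1 he2 hd2 he1 d.adj e.adj.symm hne
  have hmem := hc.mem_edges (p.support_takeUntil_subset_support hw hd1s)
    (p.support_dropUntil_subset_support hw he2s) hadj
  rw [← p.take_spec hw, SimpleGraph.Walk.edges_append, List.mem_append] at hmem
  rcases hmem with h | h
  · have := hmeet _ (SimpleGraph.Walk.snd_mem_support_of_mem_edges _ h) he2s
    exact hwH (this ▸ he2)
  · have := hmeet _ hd1s (SimpleGraph.Walk.fst_mem_support_of_mem_edges _ h)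
    exact hwH (this ▸ hd1)

/-- In a connected graph, a set is a halfspace exactly if the vertices on either side of the cut
form a clique. -/
lemma isMHalfspace_iff (hG : G.Connected) {H : Set V} :
    IsMHalfspace G H ↔ BoundaryClique G H ∧ BoundaryClique G Hᶜ :=
  ⟨fun h => ⟨h.1.boundaryClique hG h.2, h.2.boundaryClique hG (by simpa using h.1)⟩,
    fun h => ⟨h.1.isMConvex, h.2.isMConvex⟩⟩

end Boundary

/-! ### Tight cut edges -/

section Tight

universe u

variable {V : Type u} {G : SimpleGraph V}

/-- No common neighbour `u ∉ H` of `a` and `b` sees strictly more of `H` than `b` does: if `u` has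
a neighbour in `H` that `b` misses, then `b` has a neighbour in `H` that `u` misses. -/
def Dominant (G : SimpleGraph V) (a b : V) (H : Set V) : Prop :=
  ∀ ⦃u x⦄, u ∉ H → G.Adj u a → G.Adj u b → x ∈ H → G.Adj x u → ¬G.Adj x b →
    ∃ w ∈ H, G.Adj w b ∧ ¬G.Adj w u

/-- `H` is a halfspace of a connected graph, `a ∈ H`, `b ∉ H`, and the pair `(a, b)` is locally
optimal among the pairs cut by `H`. -/
structure Tight (G : SimpleGraph V) (a b : V) (H : Set V) : Prop where
  clique : BoundaryClique G H
  clique_compl : BoundaryClique G Hᶜ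
  left_mem : a ∈ H
  right_notMem : b ∉ H
  dominant : Dominant G a b H
  dominant_compl : Dominant G b a Hᶜ

variable {a b : V} {H : Set V}

lemma Tight.compl (h : Tight G a b H) : Tight G b a Hᶜ where
  clique := h.clique_compl
  clique_compl := by simpa using h.clique
  left_mem := h.right_notMem
  right_notMem := by simpa using h.left_mem
  dominant := h.dominant_compl
  dominant_compl := by simpa using h.dominant

lemma Tight.mem_of_adj_left (h : Tight G a b H) (hab : G.Adj a b) {x : V} (hx : G.Adj x a)
    (hxb : x ≠ b) (hxb' : ¬G.Adj x b) : x ∈ H := by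
  by_contra hxH
  have ha : a ∉ Hᶜ := by simpa using h.left_mem
  exact hxb' (h.clique_compl hxH h.right_notMem ha ha hx hab.symm hxb)

lemma Tight.notMem_of_adj_right (h : Tight G a b H) (hab : G.Adj a b) {y : V} (hy : G.Adj y b)
    (hya : y ≠ a) (hya' : ¬G.Adj y a) : y ∉ H :=
  h.compl.mem_of_adj_left hab.symm hy hya hya'

lemma Tight.mem_iff_notMem (h : Tight G a b H) {u v : V} (hua : G.Adj u a) (hub : G.Adj u b)
    (hva : G.Adj v a) (hvb : G.Adj v b) (hne : u ≠ v) (huv : ¬G.Adj u v) : u ∈ H ↔ v ∉ H := by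
  have ha : a ∉ Hᶜ := by simpa using h.left_mem
  constructor
  · intro hu hv
    exact huv (h.clique hu hv h.right_notMem h.right_notMem hub hvb hne)
  · intro hv
    by_contra hu
    exact huv (h.clique_compl hu hv ha ha hua hva hne)

lemma Tight.near_left (h : Tight G a b H) (hab : G.Adj a b) {x y : V} (hx : x ∈ H) (hy : y ∉ H)
    (hxy : G.Adj x y) : x = a ∨ G.Adj x a := by
  by_cases hxa : x = a
  · exact Or.inl hxa
  · exact Or.inr (h.clique hx h.left_mem hy h.right_notMem hxy hab hxa)

lemma Tight.near_right (h : Tight G a b H) (hab : G.Adj a b) {x y : V} (hx : x ∈ H) (hy : y ∉ H)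
    (hxy : G.Adj x y) : y = b ∨ G.Adj y b :=
  h.compl.near_left hab.symm hy (by simpa using hx) hxy.symm

/-- `X` is the symmetric difference of the three sets `H 0`, `H 1`, `H 2`. -/
def IsSum (H : Fin 3 → Set V) (X : Set V) : Prop :=
  ∀ v, v ∈ X ↔ ((v ∈ H 0 ↔ v ∈ H 1) ↔ v ∈ H 2)

namespace IsSum

variable {H : Fin 3 → Set V} {X : Set V}

lemma compl (hX : IsSum H X) : IsSum (fun i => (H i)ᶜ) Xᶜ := by
  intro v
  have := hX v
  simp only [Set.mem_compl_iff]
  tauto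

lemma mem (hX : IsSum H X) {v : V} (h : ∀ i, v ∈ H i) : v ∈ X := by
  have := hX v
  have := h 0
  have := h 1
  have := h 2
  tauto

lemma notMem (hX : IsSum H X) {v : V} (h : ∀ i, v ∉ H i) : v ∉ X := by
  have := hX v
  have := h 0
  have := h 1
  have := h 2
  tauto

lemma exists_notMem (hX : IsSum H X) {v : V} (h : v ∉ X) : ∃ i, v ∉ H i := by
  by_contra hc
  push Not at hc
  exact h (hX.mem hc)

lemma mem_iff_notMem (hX : IsSum H X) {u v : V} (h : ∀ i, u ∈ H i ↔ v ∉ H i) :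
    u ∈ X ↔ v ∉ X := by
  have := hX v
  have := hX u
  have := h 0
  have := h 1
  have := h 2
  tauto

lemma exists_separating (hX : IsSum H X) {x y : V} (hx : x ∈ X) (hy : y ∉ X) :
    ∃ i, x ∈ H i ∧ y ∉ H i ∨ x ∉ H i ∧ y ∈ H i := by
  by_contra hc
  push Not at hc
  have := hX x
  have := hX y
  have := hc 0
  have := hc 1
  have := hc 2
  tauto

variable (hX : IsSum H X) (hH : ∀ i, Tight G a b (H i)) (hab : G.Adj a b)
include hX hH hab

/-- Every edge cut by a sum starts at `a` or at a neighbour of `a`. -/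
lemma near_left {x y : V} (hx : x ∈ X) (hy : y ∉ X) (hxy : G.Adj x y) : x = a ∨ G.Adj x a := by
  obtain ⟨i, ⟨hxi, hyi⟩ | ⟨hxi, hyi⟩⟩ := hX.exists_separating hx hy
  · exact (hH i).near_left hab hxi hyi hxy
  · by_contra! hc
    -- here `x` is adjacent to `b` but not to `a`, which keeps it out of every `H j`
    rcases (hH i).near_right hab hyi hxi hxy.symm with rfl | hxb
    · exact hX.notMem (fun j => (hH j).right_notMem) hx
    · exact hX.notMem (fun j => (hH j).notMem_of_adj_right hab hxb hc.1 hc.2) hx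

lemma near_right {x y : V} (hx : x ∈ X) (hy : y ∉ X) (hxy : G.Adj x y) : y = b ∨ G.Adj y b :=
  hX.compl.near_left (fun i => (hH i).compl) hab.symm hy (by simpa using hx) hxy.symm

lemma adj_right_of_adj {x u : V} (hxa : G.Adj x a) (hxb : x ≠ b) (hxb' : ¬G.Adj x b)
    (hu : u ∉ X) (hux : G.Adj x u) : G.Adj u b := by
  have hx : x ∈ X := hX.mem fun i => (hH i).mem_of_adj_left hab hxa hxb hxb'
  rcases hX.near_right hH hab hx hu hux with rfl | h
  · exact absurd hux hxb'
  · exact h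

/-- A common neighbour `w` of `a` and `b` that is not adjacent to `u` always lies on the other side
of the cut than `u`. -/
lemma exists_complementary {i : Fin 3} {x u : V} (hui : u ∉ H i) (hua : G.Adj u a)
    (hub : G.Adj u b) (hxa : G.Adj x a) (hxb : x ≠ b) (hxb' : ¬G.Adj x b) (hxu : G.Adj x u) :
    ∃ w, G.Adj w x ∧ (∀ j, w ∈ H j ↔ u ∉ H j) ∧ (w ∈ X ↔ u ∉ X) ∧ G.Adj w b ∧ ¬G.Adj w u := by
  have hxi := (hH i).mem_of_adj_left hab hxa hxb hxb'
  obtain ⟨w, hwi, hwb, hwu⟩ := (hH i).dominant hui hua hub hxi hxu hxb'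
  have hwa : G.Adj w a := by
    rcases (hH i).near_left hab hwi (hH i).right_notMem hwb with rfl | h
    · exact absurd hua.symm hwu
    · exact h
  have hwu' : w ≠ u := by
    rintro rfl
    exact hui hwi
  have hwx : w ≠ x := by
    rintro rfl
    exact hxb' hwb
  have hall : ∀ j, w ∈ H j ↔ u ∉ H j :=
    fun j => (hH j).mem_iff_notMem hwa hwb hua hub hwu' hwu
  exact ⟨w, (hH i).clique hwi hxi (hH i).right_notMem hui hwb hxu hwx, hall,
    hX.mem_iff_notMem hall, hwb, hwu⟩

/-- The implications of the form `v ∈ H → u ∈ H` between common neighbours of `a` and `b` collapse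
on the tight halfspaces: once `u` is left out by a sum, `v` is left out by every summand. -/
lemma notMem_of_notMem {v x u : V} (hvb : G.Adj v b)
    (hxa : G.Adj x a) (hxb : x ≠ b) (hxb' : ¬G.Adj x b) (hvx : ¬G.Adj v x) (hxu : G.Adj x u)
    (hu : u ∉ X) (j : Fin 3) : v ∉ H j := by
  have hvx' : v ≠ x := by
    rintro rfl
    exact hxb' hvb
  have hub := hX.adj_right_of_adj hH hab hxa hxb hxb' hu hxu
  have hxj := (hH j).mem_of_adj_left hab hxa hxb hxb'
  have block : ∀ y, y ∉ H j → G.Adj x y → v ∉ H j := fun y hy hxy hv =>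
    hvx ((hH j).clique hv hxj (hH j).right_notMem hy hvb hxy hvx')
  by_cases hua : G.Adj u a
  · obtain ⟨i, hui⟩ := hX.exists_notMem hu
    obtain ⟨w, hwx, hw, -⟩ := hX.exists_complementary hH hab hui hua hub hxa hxb hxb' hxu
    by_cases huj : u ∈ H j
    · exact block w (by simp [hw, huj]) hwx.symm
    · exact block u huj hxu
  · have hua' : u ≠ a := by
      rintro rfl
      exact hu (hX.mem fun i => (hH i).left_mem)
    exact block u ((hH j).notMem_of_adj_right hab hub hua' hua) hxu

/-- Two nonadjacent neighbours `x`, `x'` of `a` that are not adjacent to `b` lie in every tight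
halfspace, so they cannot both have a neighbour that a sum leaves out. -/
lemma not_both_notMem {x x' u u' : V} (hxa : G.Adj x a) (hxb : x ≠ b) (hxb' : ¬G.Adj x b)
    (hxa' : G.Adj x' a) (hxb₁ : x' ≠ b) (hxb₁' : ¬G.Adj x' b) (hne : x ≠ x')
    (hadj : ¬G.Adj x x') (hxu : G.Adj x u) (hxu' : G.Adj x' u') (hu : u ∉ X) : u' ∈ X := by
  by_contra hu'
  have hub := hX.adj_right_of_adj hH hab hxa hxb hxb' hu hxu
  have block : ∀ j, u ∉ H j → ∀ z, G.Adj x' z → z ∈ H j := by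
    intro j huj z hz
    by_contra hzj
    exact hadj ((hH j).clique ((hH j).mem_of_adj_left hab hxa hxb hxb')
      ((hH j).mem_of_adj_left hab hxa' hxb₁ hxb₁') huj hzj hxu hz hne)
  have main : ¬∀ j, u ∉ H j := fun h => hu' (hX.mem fun j => block j (h j) u' hxu')
  by_cases hux' : G.Adj u x'
  · obtain ⟨i, hi⟩ := hX.exists_notMem hu
    exact hi (block i hi u hux'.symm)
  · exact main (hX.notMem_of_notMem hH hab hub hxa' hxb₁ hxb₁' hux' hxu' hu')

lemma boundaryClique : BoundaryClique G X := by
  intro x x' y y' hx hx' hy hy' hxy hxy' hne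
  by_contra hadj
  have hbX : b ∉ X := hX.notMem fun i => (hH i).right_notMem
  have hxb : x ≠ b := by
    rintro rfl
    exact hbX hx
  have hxb' : x' ≠ b := by
    rintro rfl
    exact hbX hx'
  have hxa := hX.near_left hH hab hx hy hxy
  have hxa' := hX.near_left hH hab hx' hy' hxy'
  replace hxa : G.Adj x a := by
    rcases hxa with rfl | h
    · rcases hxa' with rfl | h'
      · exact absurd rfl hne
      · exact absurd h'.symm hadj
    · exact h
  replace hxa' : G.Adj x' a := by
    rcases hxa' with rfl | h'
    · exact absurd hxa hadj
    · exact h'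
  by_cases hb : G.Adj x b <;> by_cases hb' : G.Adj x' b
  · have := hX.mem_iff_notMem fun i => (hH i).mem_iff_notMem hxa hb hxa' hb' hne hadj
    exact this.1 hx hx'
  · exact hX.notMem (hX.notMem_of_notMem hH hab hb hxa' hxb' hb' hadj hxy' hy') hx
  · exact hX.notMem (hX.notMem_of_notMem hH hab hb' hxa hxb hb
      (fun h => hadj h.symm) hxy hy) hx'
  · exact hy' (hX.not_both_notMem hH hab hxa hxb hb hxa' hxb' hb' hne hadj hxy hxy' hy)

lemma dominant : Dominant G a b X := by
  intro u x hu hua hub hx hxu hxb'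
  have hxb : x ≠ b := by
    rintro rfl
    exact hX.notMem (fun i => (hH i).right_notMem) hx
  have hxa : G.Adj x a := by
    rcases hX.near_left hH hab hx hu hxu with rfl | h
    · exact absurd hab hxb'
    · exact h
  obtain ⟨i, hi⟩ := hX.exists_notMem hu
  obtain ⟨w, -, -, hw, hwb, hwu⟩ :=
    hX.exists_complementary hH hab hi hua hub hxa hxb hxb' hxu
  exact ⟨w, hw.2 hu, hwb, hwu⟩

/-- The tight halfspaces of a fixed edge form an affine space over the field with two elements. -/
lemma tight : Tight G a b X where
  clique := hX.boundaryClique hH hab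
  clique_compl := hX.compl.boundaryClique (fun i => (hH i).compl) hab.symm
  left_mem := hX.mem fun i => (hH i).left_mem
  right_notMem := hX.notMem fun i => (hH i).right_notMem
  dominant := hX.dominant hH hab
  dominant_compl := hX.compl.dominant (fun i => (hH i).compl) hab.symm

end IsSum

/-- A cut edge `ab` with the most cut edges at `a` and at `b` is tight. -/
lemma exists_tight [Finite V] (hG : G.Connected) {H : Set V} (hH : IsMHalfspace G H)
    (hne : H.Nonempty) (hne' : Hᶜ.Nonempty) : ∃ a b, G.Adj a b ∧ Tight G a b H := by
  classical
  cases nonempty_fintype V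
  obtain ⟨h1, h2⟩ := (isMHalfspace_iff hG).1 hH
  obtain ⟨s, hs⟩ := hne
  obtain ⟨t, ht⟩ := hne'
  obtain ⟨p⟩ := hG.preconnected s t
  obtain ⟨d, -, hd1, hd2⟩ := p.exists_boundary_dart H hs ht
  let E : Finset (V × V) := Finset.univ.filter fun e => G.Adj e.1 e.2 ∧ e.1 ∈ H ∧ e.2 ∉ H
  let A : V → Finset V := fun v => Finset.univ.filter fun w => G.Adj w v ∧ w ∈ H
  let B : V → Finset V := fun v => Finset.univ.filter fun w => G.Adj w v ∧ w ∉ H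
  obtain ⟨⟨a, b⟩, he, hmax⟩ := Finset.exists_max_image E (fun e => (B e.1).card + (A e.2).card)
    ⟨(d.fst, d.snd), by simp [E, hd1, hd2]⟩
  simp only [E, Finset.mem_filter, Finset.mem_univ, true_and, Prod.forall] at he hmax
  refine ⟨a, b, he.1, h1, h2, he.2.1, he.2.2, ?_, ?_⟩
  · intro u x hu hua hub hx hxu hxb
    by_contra! hc
    have hlt : A b ⊂ A u := by
      rw [Finset.ssubset_iff_of_subset]
      · exact ⟨x, by simp [A, hx, hxu], by simp [A, hxb]⟩
      · intro w hw
        simp only [A, Finset.mem_filter, Finset.mem_univ, true_and] at hw ⊢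
        exact ⟨hc w hw.2 hw.1, hw.2⟩
    have := Finset.card_lt_card hlt
    have := hmax a u ⟨hua.symm, he.2.1, hu⟩
    omega
  · intro u x hu hub hua hx hxu hxa
    by_contra! hc
    have hlt : B a ⊂ B u := by
      rw [Finset.ssubset_iff_of_subset]
      · refine ⟨x, ?_, by simp [B, hxa]⟩
        simpa [B, hxu] using hx
      · intro w hw
        simp only [B, Finset.mem_filter, Finset.mem_univ, true_and] at hw ⊢
        exact ⟨hc w hw.2 hw.1, hw.2⟩
    have := Finset.card_lt_card hlt
    have := hmax u b ⟨hub, by simpa using hu, he.2.2⟩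
    omega

end Tight

/-! ### Affine set families and the counting bound -/

section Counting

universe u

variable {V : Type u} [Fintype V] [DecidableEq V]

/-- A family of sets that is affine over the field with two elements shatters a set `S` with
`2 ^ #S` at least the size of the family: any minimal `S` on which the members differ will do. -/
lemma exists_shatters_of_affine {F : Finset (Finset V)} (hne : F.Nonempty)
    (hF : ∀ A ∈ F, ∀ B ∈ F, ∀ C ∈ F, symmDiff (symmDiff A B) C ∈ F) :
    ∃ S, F.Shatters S ∧ F.card ≤ 2 ^ S.card := by
  obtain ⟨S, hS, hmin⟩ := Finset.exists_min_image
    (Finset.univ.filter fun S : Finset V => ∀ A ∈ F, ∀ B ∈ F, S ∩ A = S ∩ B → A = B)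
    Finset.card ⟨Finset.univ, by simp⟩
  simp only [Finset.mem_filter, Finset.mem_univ, true_and] at hS hmin
  -- by minimality, every single element of `S` can be flipped
  have flip : ∀ s ∈ S, ∀ A ∈ F, ∃ A' ∈ F, S ∩ A' = symmDiff (S ∩ A) {s} := by
    intro s hs A hA
    have h1 := mt (hmin (S.erase s)) (not_le.2 (Finset.card_erase_lt_of_mem hs))
    push Not at h1
    obtain ⟨B, hB, C, hC, hBC, hne⟩ := h1
    have h2 : S ∩ B ≠ S ∩ C := fun h => hne (hS B hB C hC h)
    refine ⟨_, hF A hA B hB C hC, ?_⟩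
    have h3 : ∀ v, v ≠ s → v ∈ S → (v ∈ B ↔ v ∈ C) := by
      intro v hv hvS
      have := Finset.ext_iff.1 hBC v
      simpa [hv, hvS] using this
    have h4 : ¬(s ∈ B ↔ s ∈ C) := by
      intro h
      apply h2
      ext v
      by_cases hv : v = s
      · subst hv
        simp [h]
      · simp only [Finset.mem_inter, and_congr_right_iff]
        exact h3 v hv
    ext v
    simp only [Finset.mem_inter, Finset.mem_symmDiff, Finset.mem_singleton]
    by_cases hv : v = s
    · subst hv
      tauto
    · have := h3 v hv
      tauto
  have reach : ∀ D ⊆ S, ∀ A ∈ F, ∃ A' ∈ F, S ∩ A' = symmDiff (S ∩ A) D := by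
    intro D
    induction D using Finset.induction_on with
    | empty => exact fun _ A hA => ⟨A, hA, by rw [← Finset.bot_eq_empty, symmDiff_bot]⟩
    | insert s D hs ih =>
      intro hD A hA
      rw [Finset.insert_subset_iff] at hD
      obtain ⟨A₁, hA₁, h1⟩ := ih hD.2 A hA
      obtain ⟨A₂, hA₂, h2⟩ := flip s hD.1 A₁ hA₁
      refine ⟨A₂, hA₂, ?_⟩
      rw [h2, h1, symmDiff_assoc]
      congr 1
      ext v
      simp only [Finset.mem_symmDiff, Finset.mem_singleton, Finset.mem_insert]
      by_cases hv : v = s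
      · subst hv
        tauto
      · tauto
  refine ⟨S, ?_, ?_⟩
  · intro T hT
    obtain ⟨A, hA⟩ := hne
    obtain ⟨A', hA', h⟩ := reach (symmDiff (S ∩ A) T)
      (symmDiff_le_sup.trans (Finset.union_subset Finset.inter_subset_left hT)) A hA
    exact ⟨A', hA', by rw [h, symmDiff_symmDiff_cancel_left]⟩
  · rw [← Finset.card_powerset]
    exact Finset.card_le_card_of_injOn (fun A => S ∩ A)
      (fun A _ => by simp) (fun A hA B hB h => hS A hA B hB h)

variable {G : SimpleGraph V}

@[simp]
lemma mem_mHalfspaces {V : Type u} [Fintype V] {G : SimpleGraph V} {H : Finset V} :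
    H ∈ mHalfspaces G ↔ IsMHalfspace G (H : Set V) := by
  simp [mHalfspaces]

lemma compl_mem_mHalfspaces {H : Finset V} (hH : H ∈ mHalfspaces G) : Hᶜ ∈ mHalfspaces G := by
  rw [mem_mHalfspaces] at *
  rw [Finset.coe_compl]
  exact ⟨hH.2, by simpa using hH.1⟩

open Classical in
/-- The halfspaces for which the edge `ab` is tight. -/
noncomputable def tightHalfspaces (G : SimpleGraph V) (a b : V) : Finset (Finset V) :=
  Finset.univ.filter fun H => Tight G a b (H : Set V)

lemma isSum_symmDiff {V : Type u} [DecidableEq V] (A B C : Finset V) :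
    IsSum ![(A : Set V), B, C] (symmDiff (symmDiff A B) C : Finset V) := by
  intro v
  simp only [Finset.mem_coe, Finset.mem_symmDiff, Matrix.cons_val_zero, Matrix.cons_val_one,
    Matrix.cons_val]
  tauto

/-- The tight halfspaces of `ab` are the elements of an affine space all of which contain `a`;
together with their complements they therefore shatter one more vertex, namely `a`. -/
lemma two_mul_card_tightHalfspaces_le (hG : G.Connected) {a b : V} (hab : G.Adj a b) :
    2 * (tightHalfspaces G a b).card ≤ 2 ^ (mHalfspaces G).vcDim := by
  rcases (tightHalfspaces G a b).eq_empty_or_nonempty with h0 | hne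
  · simp [h0]
  have hsub : ∀ H ∈ tightHalfspaces G a b, H ∈ mHalfspaces G ∧ a ∈ H := by
    intro H hH
    simp only [tightHalfspaces, Finset.mem_filter, Finset.mem_univ, true_and] at hH
    exact ⟨by rw [mem_mHalfspaces, isMHalfspace_iff hG]; exact ⟨hH.clique, hH.clique_compl⟩,
      hH.left_mem⟩
  obtain ⟨S, hS, hcard⟩ := exists_shatters_of_affine hne (by
    intro A hA B hB C hC
    simp only [tightHalfspaces, Finset.mem_filter, Finset.mem_univ, true_and] at hA hB hC ⊢
    refine (isSum_symmDiff A B C).tight (fun i => ?_) hab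
    fin_cases i
    · exact hA
    · exact hB
    · exact hC)
  have haS : a ∉ S := by
    intro ha
    obtain ⟨H, hH, h⟩ := hS (Finset.empty_subset S)
    have := Finset.mem_inter.2 ⟨ha, (hsub H hH).2⟩
    simp [h] at this
  have hS' : (mHalfspaces G).Shatters (insert a S) := by
    intro T hT
    by_cases haT : a ∈ T
    · obtain ⟨H, hH, h⟩ := hS (Finset.inter_subset_left : S ∩ T ⊆ S)
      refine ⟨H, (hsub H hH).1, ?_⟩
      ext v
      have h1 := Finset.ext_iff.1 h v
      have h2 := @hT v
      simp only [Finset.mem_inter, Finset.mem_insert] at h1 h2 ⊢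
      by_cases hv : v = a
      · subst hv
        simp [haT, (hsub H hH).2]
      · tauto
    · obtain ⟨H, hH, h⟩ := hS (Finset.sdiff_subset : S \ T ⊆ S)
      refine ⟨Hᶜ, compl_mem_mHalfspaces (hsub H hH).1, ?_⟩
      ext v
      have h1 := Finset.ext_iff.1 h v
      have h2 := @hT v
      simp only [Finset.mem_inter, Finset.mem_insert, Finset.mem_sdiff,
        Finset.mem_compl] at h1 h2 ⊢
      by_cases hv : v = a
      · subst hv
        simp [haT, (hsub H hH).2]
      · tauto
  have hd := hS'.card_le_vcDim
  rw [Finset.card_insert_of_notMem haS] at hd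
  calc 2 * (tightHalfspaces G a b).card ≤ 2 * 2 ^ S.card := by gcongr
    _ = 2 ^ (S.card + 1) := by ring
    _ ≤ _ := Nat.pow_le_pow_right (by norm_num) hd

lemma card_mHalfspaces_le (hG : G.Connected) :
    (mHalfspaces G).card ≤ G.edgeSet.ncard * 2 ^ (mHalfspaces G).vcDim + 2 := by
  classical
  have hcover : mHalfspaces G ⊆ {∅, Finset.univ} ∪
      (Finset.univ : Finset G.Dart).biUnion fun d => tightHalfspaces G d.fst d.snd := by
    intro H hH
    rw [mem_mHalfspaces] at hH
    simp only [Finset.mem_union, Finset.mem_insert, Finset.mem_singleton, Finset.mem_biUnion,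
      Finset.mem_univ, true_and]
    by_contra! hc
    obtain ⟨a, b, hab, ht⟩ := exists_tight hG hH
      (by simpa [Finset.nonempty_iff_ne_empty] using hc.1.1)
      (by simpa [Set.nonempty_compl] using hc.1.2)
    exact hc.2 ⟨(a, b), hab⟩ (by simpa [tightHalfspaces] using ht)
  have h1 := (Finset.card_le_card hcover).trans (Finset.card_union_le _ _)
  have h2 : ((Finset.univ : Finset G.Dart).biUnion
      fun d => tightHalfspaces G d.fst d.snd).card * 2 ≤
      2 * G.edgeSet.ncard * 2 ^ (mHalfspaces G).vcDim := by
    have h3 : Fintype.card G.Dart = 2 * G.edgeSet.ncard := by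
      rw [G.dart_card_eq_twice_card_edges, ← SimpleGraph.coe_edgeFinset, Set.ncard_coe_finset]
    calc _ ≤ (∑ d : G.Dart, (tightHalfspaces G d.fst d.snd).card) * 2 := by
          gcongr
          exact Finset.card_biUnion_le
      _ = ∑ d : G.Dart, 2 * (tightHalfspaces G d.fst d.snd).card := by
          rw [Finset.sum_mul]
          exact Finset.sum_congr rfl fun _ _ => mul_comm _ _
      _ ≤ ∑ _d : G.Dart, 2 ^ (mHalfspaces G).vcDim :=
          Finset.sum_le_sum fun d _ => two_mul_card_tightHalfspaces_le hG d.adj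
      _ = _ := by
          rw [Finset.sum_const, Finset.card_univ, h3, smul_eq_mul]
  have h4 : ({∅, Finset.univ} : Finset (Finset V)).card ≤ 2 := Finset.card_le_two
  nlinarith

end Counting

/-! ### Two-satisfiability by unit propagation -/

section TwoSat

/-- The negation of a literal; the literal `(i, α)` says that variable `i` has the value `α`. -/
def neg (l : ℕ × Bool) : ℕ × Bool := (l.1, !l.2)

@[simp]
lemma neg_neg (l : ℕ × Bool) : neg (neg l) = l := by
  simp [neg]

/-- The literals over the variables `0, …, n - 1`. -/
def lits (n : ℕ) : List (ℕ × Bool) :=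
  (List.range n).flatMap fun i => [(i, false), (i, true)]

@[simp]
lemma mem_lits {n : ℕ} {l : ℕ × Bool} : l ∈ lits n ↔ l.1 < n := by
  obtain ⟨i, α⟩ := l
  cases α <;> simp [lits, eq_comm]

lemma length_lits (n : ℕ) : (lits n).length = n * 2 := by
  simp [lits, List.length_flatMap]

/-- One round of unit propagation: `clash l l'` forbids that `l` and `l'` are both true, so a true
literal `l'` with `clash l' (neg l)` makes `l` true. -/
def propagate (clash : ℕ × Bool → ℕ × Bool → Bool) (n : ℕ) (S : List (ℕ × Bool)) :
    List (ℕ × Bool) :=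
  (lits n).filter fun l => S.any fun l' => l == l' || clash l' (neg l)

/-- All literals that follow from `S` by unit propagation; `2 * n + 2` rounds reach a fixed
point. -/
def closure (clash : ℕ × Bool → ℕ × Bool → Bool) (n : ℕ) (S : List (ℕ × Bool)) :
    List (ℕ × Bool) :=
  propagate clash n (propagate clash n ((lits n).foldl (fun T _ => propagate clash n T) S))

/-- Unit propagation from `S` does not run into a contradiction. -/
def consistent (clash : ℕ × Bool → ℕ × Bool → Bool) (n : ℕ) (S : List (ℕ × Bool)) : Bool :=
  (closure clash n S).all fun l => (closure clash n S).all fun l' =>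
    !(clash l l' || l' == neg l)

/-- The literals fixed by the partial assignment `q` of the first variables. -/
def prefixLits (n : ℕ) (q : List Bool) : List (ℕ × Bool) :=
  (lits n).filter fun l => q.getD l.1 (!l.2) == l.2

/-- Decides whether `q` extends to a solution of the system of two-clauses given by `clash`. -/
def satisfiable (clash : ℕ × Bool → ℕ × Bool → Bool) (n : ℕ) (q : List Bool) : Bool :=
  consistent clash n (prefixLits n q) && (List.range n).all fun v =>
    consistent clash n [(v, false)] || consistent clash n [(v, true)]

variable {clash : ℕ × Bool → ℕ × Bool → Bool} {n : ℕ} {S : List (ℕ × Bool)}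

lemma mem_propagate {l : ℕ × Bool} : l ∈ propagate clash n S ↔
    l.1 < n ∧ ∃ l' ∈ S, l = l' ∨ clash l' (neg l) = true := by
  simp [propagate, List.any_eq_true]

lemma closure_eq_iterate :
    closure clash n S = (propagate clash n)^[n * 2 + 2] S := by
  have : ∀ (L : List (ℕ × Bool)) (T : List (ℕ × Bool)),
      L.foldl (fun T _ => propagate clash n T) T = (propagate clash n)^[L.length] T := by
    intro L
    induction L with
    | nil => intro T; rfl
    | cons l L ih => intro T; exact ih _
  rw [closure, this, length_lits, Function.iterate_succ_apply', Function.iterate_succ_apply']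

lemma propagate_closure : propagate clash n (closure clash n S) = closure clash n S := by
  set f := propagate clash n with hf
  -- the iterates are sublists of `lits n` that grow strictly until they become stationary
  have key : ∀ k, f (f^[k + 1] S) = f^[k + 1] S ∨ k ≤ (f^[k + 1] S).length := by
    intro k
    induction k with
    | zero => exact Or.inr (Nat.zero_le _)
    | succ k ih =>
      rw [Function.iterate_succ_apply' f (k + 1)]
      rcases ih with h | h
      · exact Or.inl (by rw [h, h])
      · by_cases heq : f (f^[k + 1] S) = f^[k + 1] S
        · exact Or.inl (by rw [heq, heq])
        · right
          have hsub : List.Sublist (f^[k + 1] S) (f (f^[k + 1] S)) := by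
            rw [Function.iterate_succ_apply' f k]
            set T := f^[k] S
            have : f T = (f (f T)).filter fun l => T.any fun l' => l == l' || clash l' (neg l) := by
              rw [hf, propagate, propagate, List.filter_filter]
              refine List.filter_congr fun l hl => ?_
              rw [Bool.eq_iff_iff, Bool.and_eq_true, iff_self_and]
              intro h
              rw [List.any_eq_true]
              exact ⟨l, List.mem_filter.2 ⟨hl, h⟩, by simp⟩
            nth_rw 1 [this]
            exact List.filter_sublist
          have := hsub.length_le
          have : (f^[k + 1] S).length ≠ (f (f^[k + 1] S)).length :=
            fun h => heq (hsub.eq_of_length h).symm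
          omega
  rw [closure_eq_iterate]
  rcases key (n * 2 + 1) with h | h
  · exact h
  · rw [Function.iterate_succ_apply'] at h
    have : (f (f^[n * 2 + 1] S)).length ≤ n * 2 := by
      rw [← length_lits]
      exact (List.filter_sublist).length_le
    omega

lemma subset_closure (hS : ∀ l ∈ S, l.1 < n) {l : ℕ × Bool} (hl : l ∈ S) :
    l ∈ closure clash n S := by
  rw [closure_eq_iterate]
  generalize n * 2 + 2 = k
  induction k with
  | zero => exact hl
  | succ k ih =>
    rw [Function.iterate_succ_apply']
    exact mem_propagate.2 ⟨hS l hl, l, ih, Or.inl rfl⟩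

/-- Unit propagation preserves every property that passes from the premise to the conclusion of a
clause. -/
lemma closure_induction {P : ℕ × Bool → Prop} (hS : ∀ l ∈ S, P l)
    (h : ∀ l l', P l' → l.1 < n → clash l' (neg l) = true → P l) :
    ∀ l ∈ closure clash n S, P l := by
  rw [closure_eq_iterate]
  generalize n * 2 + 2 = k
  induction k with
  | zero => exact hS
  | succ k ih =>
    rw [Function.iterate_succ_apply']
    intro l hl
    obtain ⟨hn, l', hl', rfl | hc⟩ := mem_propagate.1 hl
    · exact ih l hl'
    · exact h l l' (ih l' hl') hn hc

lemma lt_of_mem_closure {l : ℕ × Bool} (hl : l ∈ closure clash n S) : l.1 < n := by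
  rw [← propagate_closure] at hl
  exact (mem_propagate.1 hl).1

/-- A set of literals that is closed under unit propagation and free of contradictions. -/
structure IsPartialModel (clash : ℕ × Bool → ℕ × Bool → Bool) (n : ℕ) (T : Set (ℕ × Bool)) :
    Prop where
  lt : ∀ l ∈ T, l.1 < n
  closed : ∀ l l', l' ∈ T → l.1 < n → clash l' (neg l) = true → l ∈ T
  no_clash : ∀ l ∈ T, ∀ l' ∈ T, clash l l' = false
  no_neg : ∀ l ∈ T, neg l ∉ T

lemma isPartialModel_closure (h : consistent clash n S = true) :
    IsPartialModel clash n {l | l ∈ closure clash n S} where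
  lt l hl := lt_of_mem_closure hl
  closed l l' hl' hln hc := by
    change l ∈ closure clash n S
    rw [← propagate_closure]
    exact mem_propagate.2 ⟨hln, l', hl', Or.inr hc⟩
  no_clash l hl l' hl' := by
    simp only [consistent, List.all_eq_true] at h
    simpa using (by simpa using h l hl l' hl' : _ ∧ _).1
  no_neg l hl hl' := by
    simp only [consistent, List.all_eq_true] at h
    simpa using h l hl _ hl'

lemma consistent_of_model {σ : ℕ → Bool}
    (hσ : ∀ i < n, ∀ j < n, clash (i, σ i) (j, σ j) = false)
    (hS : ∀ l ∈ S, l.1 < n ∧ σ l.1 = l.2) : consistent clash n S = true := by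
  have key : ∀ l ∈ closure clash n S, l.1 < n ∧ σ l.1 = l.2 := by
    refine closure_induction hS ?_
    rintro ⟨i, α⟩ ⟨j, β⟩ ⟨hj, hβ⟩ hi hc
    dsimp only at hj hβ hi ⊢
    subst hβ
    refine ⟨hi, ?_⟩
    by_contra hne
    have := hσ j hj i hi
    have h2 : σ i = !α := Bool.eq_not.2 hne
    simp_all [neg]
  simp only [consistent, List.all_eq_true]
  rintro ⟨i, α⟩ hl ⟨j, β⟩ hl'
  obtain ⟨hi, hα⟩ := key _ hl
  obtain ⟨hj, hβ⟩ := key _ hl'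
  dsimp only at hi hj hα hβ
  subst hα hβ
  have := hσ i hi j hj
  simp only [this, neg, Bool.false_or, Bool.not_eq_true', beq_eq_false_iff_ne, ne_eq,
    Prod.mk.injEq, not_and]
  rintro rfl
  simp

/-- A partial model that leaves `v` undecided can be merged with the closure of a literal of `v`: if
the closure contradicted the partial model, then propagating the contradiction backwards would show
that the latter decides `v`. -/
lemma IsPartialModel.union (hsymm : ∀ l l', clash l l' = clash l' l) {T : Set (ℕ × Bool)}
    (hT : IsPartialModel clash n T) {l₀ : ℕ × Bool} (hl₀n : l₀.1 < n) (hl₀ : neg l₀ ∉ T)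
    (hc : consistent clash n [l₀] = true) :
    IsPartialModel clash n (T ∪ {l | l ∈ closure clash n [l₀]}) := by
  have hU := isPartialModel_closure hc
  have cross : ∀ l ∈ closure clash n [l₀], l.1 < n ∧ neg l ∉ T := by
    refine closure_induction (by simpa using ⟨hl₀n, hl₀⟩) ?_
    rintro l l' ⟨hl', hl'T⟩ hl hcl
    refine ⟨hl, fun hlT => hl'T (hT.closed _ _ hlT hl' ?_)⟩
    rw [neg_neg, hsymm, hcl]
  have cross' : ∀ l ∈ T, ∀ l' ∈ closure clash n [l₀], clash l l' = false := by
    intro l hl l' hl'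
    by_contra hcl
    obtain ⟨hn, hnot⟩ := cross l' hl'
    exact hnot (hT.closed _ l hl hn (by simpa using hcl))
  refine ⟨?_, ?_, ?_, ?_⟩
  · rintro l (hl | hl)
    · exact hT.lt l hl
    · exact hU.lt l hl
  · rintro l l' (hl' | hl') hn hcl
    · exact Or.inl (hT.closed l l' hl' hn hcl)
    · exact Or.inr (hU.closed l l' hl' hn hcl)
  · rintro l (hl | hl) l' (hl' | hl')
    · exact hT.no_clash l hl l' hl'
    · exact cross' l hl l' hl'
    · rw [hsymm]
      exact cross' l' hl' l hl
    · exact hU.no_clash l hl l' hl'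
  · rintro l (hl | hl) (hl' | hl')
    · exact hT.no_neg l hl hl'
    · exact (cross _ hl').2 (by simpa using hl)
    · exact (cross _ hl).2 hl'
    · exact hU.no_neg l hl hl'

lemma mem_prefixLits {q : List Bool} (hq : q.length ≤ n) {l : ℕ × Bool} :
    l ∈ prefixLits n q ↔ q[l.1]? = some l.2 := by
  obtain ⟨i, α⟩ := l
  simp only [prefixLits, List.mem_filter, mem_lits, beq_iff_eq, List.getD_eq_getElem?_getD]
  rcases lt_or_ge i q.length with h | h
  · simp [h, h.trans_le hq]
  · simp [h]

/-- Unit propagation is a complete test for two-clauses: if `q` propagates consistently and every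
variable has a literal that propagates consistently, then the undecided variables can be
assigned one after the other without backtracking. -/
lemma satisfiable_iff (hsymm : ∀ l l', clash l l' = clash l' l) {q : List Bool}
    (hq : q.length ≤ n) : satisfiable clash n q = true ↔
      ∃ σ : ℕ → Bool, (∀ i < n, ∀ j < n, clash (i, σ i) (j, σ j) = false) ∧
        ∀ i < q.length, q[i]? = some (σ i) := by
  simp only [satisfiable, Bool.and_eq_true, List.all_eq_true, List.mem_range, Bool.or_eq_true]
  constructor
  · rintro ⟨h1, h2⟩
    have key : ∀ v ≤ n, ∃ T, IsPartialModel clash n T ∧ (∀ l ∈ prefixLits n q, l ∈ T) ∧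
        ∀ i < v, ∃ α, (i, α) ∈ T := by
      intro v
      induction v with
      | zero =>
        refine fun _ => ⟨_, isPartialModel_closure h1, fun l hl => ?_, by simp⟩
        exact subset_closure (fun l hl => by simpa using (List.mem_filter.1 hl).1) hl
      | succ v ih =>
        intro hv
        obtain ⟨T, hT, hqT, hdec⟩ := ih (by omega)
        by_cases hvT : ∃ α, (v, α) ∈ T
        · refine ⟨T, hT, hqT, fun i hi => ?_⟩
          rcases Nat.lt_succ_iff_lt_or_eq.1 hi with h | rfl
          · exact hdec i h
          · exact hvT
        · have : ∃ α, consistent clash n [(v, α)] = true := by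
            rcases h2 v (by omega) with h | h
            · exact ⟨_, h⟩
            · exact ⟨_, h⟩
          obtain ⟨α, hα⟩ := this
          refine ⟨_, hT.union hsymm (l₀ := (v, α)) (by simp; omega)
            (fun h => hvT ⟨_, h⟩) hα, fun l hl => Or.inl (hqT l hl), fun i hi => ?_⟩
          rcases Nat.lt_succ_iff_lt_or_eq.1 hi with h | rfl
          · obtain ⟨β, hβ⟩ := hdec i h
            exact ⟨β, Or.inl hβ⟩
          · exact ⟨α, Or.inr (subset_closure (by simpa using hv) (by simp))⟩
    obtain ⟨T, hT, hqT, hdec⟩ := key n le_rfl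
    choose! σ hσ using hdec
    refine ⟨σ, fun i hi j hj => hT.no_clash _ (hσ i hi) _ (hσ j hj), fun i hi => ?_⟩
    have hmem := hqT (i, q[i]) ((mem_prefixLits hq).2 (by simp [hi]))
    rw [List.getElem?_eq_getElem hi]
    by_contra hne
    have : neg (i, q[i]) = (i, σ i) := by
      have : σ i = !q[i] := by
        rw [Bool.eq_not]
        exact fun h => hne (by rw [h])
      simp [neg, this]
    exact hT.no_neg _ hmem (this ▸ hσ i (by omega))
  · rintro ⟨σ, hσ, hqσ⟩
    refine ⟨consistent_of_model hσ ?_, fun v hv => ?_⟩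
    · intro l hl
      rw [mem_prefixLits hq] at hl
      have hlt : l.1 < q.length := by
        by_contra hc
        simp [List.getElem?_eq_none (not_lt.1 hc)] at hl
      have := hqσ l.1 hlt
      rw [hl] at this
      exact ⟨by omega, (Option.some.inj this).symm⟩
    · cases h : σ v
      · exact Or.inl (consistent_of_model hσ (by simpa using ⟨hv, h⟩))
      · exact Or.inr (consistent_of_model hσ (by simpa using ⟨hv, h⟩))

end TwoSat

/-! ### The halfspaces separating an edge as a system of two-clauses -/

section Clash

/-- Literals that put the neighbour `x ≠ b` of `a` onto the boundary of a halfspace containing `a`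
but not `b`. If `x` is adjacent to `b`, then membership of `x` suffices. Otherwise `x` is a member
anyway, and it suffices that a neighbour of `x` is left out. -/
def trigger (adj : ℕ → ℕ → Bool) (b x : ℕ) (l : ℕ × Bool) : Bool :=
  adj x b && (l.1 == x && l.2) || !adj x b && (adj x l.1 && !l.2)

/-- The pairs of literals forbidden by the conditions that `a` is in the set and that the boundary
of the set is a clique. -/
def halfClash (adj : ℕ → ℕ → Bool) (n a b : ℕ) (l l' : ℕ × Bool) : Bool :=
  l.1 == a && (l'.1 == a && (!l.2 && !l'.2)) ||
    (l.2 && (!l'.2 && (adj l.1 l'.1 && (!(l.1 == a) && !adj l.1 a))) ||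
      (List.range n).any fun x => (List.range n).any fun x' =>
        !(x == x') && (!adj x x' && (adj x a && (adj x' a && (!(x == b) && (!(x' == b) &&
          (trigger adj b x l && trigger adj b x' l')))))))

/-- The pairs of literals forbidden for a halfspace that contains `a` but not `b`. -/
def clash (adj : ℕ → ℕ → Bool) (n a b : ℕ) (l l' : ℕ × Bool) : Bool :=
  (halfClash adj n a b l l' || halfClash adj n b a (neg l) (neg l')) ||
    (halfClash adj n a b l' l || halfClash adj n b a (neg l') (neg l))

lemma clash_symm (adj : ℕ → ℕ → Bool) (n a b : ℕ) (l l' : ℕ × Bool) :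
    clash adj n a b l l' = clash adj n a b l' l :=
  Bool.or_comm _ _

/-- The boundary of the set with characteristic function `σ` is a clique. -/
def CutClique (adj : ℕ → ℕ → Bool) (σ : ℕ → Bool) : Prop :=
  ∀ x x' y y', σ x = true → σ x' = true → σ y = false → σ y' = false → adj x y = true →
    adj x' y' = true → x ≠ x' → adj x x' = true

variable {adj : ℕ → ℕ → Bool} {n a b : ℕ} {σ : ℕ → Bool}

lemma trigger_iff {x : ℕ} {l : ℕ × Bool} : trigger adj b x l = true ↔
    (adj x b = true ∧ l = (x, true)) ∨
      (adj x b = false ∧ adj x l.1 = true ∧ l.2 = false) := by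
  obtain ⟨i, α⟩ := l
  simp [trigger]

lemma halfClash_iff {l l' : ℕ × Bool} : halfClash adj n a b l l' = true ↔
    (l = (a, false) ∧ l' = (a, false)) ∨
    (l.2 = true ∧ l'.2 = false ∧ adj l.1 l'.1 = true ∧ l.1 ≠ a ∧ adj l.1 a = false) ∨
    ∃ x < n, ∃ x' < n, x ≠ x' ∧ adj x x' = false ∧ adj x a = true ∧ adj x' a = true ∧ x ≠ b ∧
      x' ≠ b ∧ trigger adj b x l = true ∧ trigger adj b x' l' = true := by
  obtain ⟨i, α⟩ := l
  obtain ⟨j, β⟩ := l'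
  simp only [halfClash, Bool.or_eq_true, Bool.and_eq_true, beq_iff_eq, Bool.not_eq_true',
    List.any_eq_true, List.mem_range, beq_eq_false_iff_ne, Prod.mk.injEq]
  exact or_congr (by tauto) Iff.rfl

lemma eq_true_of_halfClash (ha : a < n)
    (h : ∀ i < n, ∀ j < n, halfClash adj n a b (i, σ i) (j, σ j) = false) : σ a = true := by
  by_contra hσ
  have := h a ha a ha
  rw [← Bool.not_eq_true, halfClash_iff] at this
  simp_all

lemma cutClique_of_halfClash (hadj : ∀ i j, adj i j = true → i < n ∧ j < n)
    (hsymm : ∀ i j, adj i j = adj j i)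
    (h : ∀ i < n, ∀ j < n, halfClash adj n a b (i, σ i) (j, σ j) = false) (hb : σ b = false) :
    CutClique adj σ := by
  intro x x' y y' hx hx' hy hy' hxy hxy' hne
  by_contra hxx
  have near : ∀ x y, σ x = true → σ y = false → adj x y = true → x = a ∨ adj x a = true := by
    intro x y hx hy hxy
    have := h x (hadj _ _ hxy).1 y (hadj _ _ hxy).2
    rw [← Bool.not_eq_true, halfClash_iff] at this
    by_contra! hc
    exact this (Or.inr (Or.inl ⟨hx, hy, hxy, hc.1, by simpa using hc.2⟩))
  have hxa : adj x a = true := by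
    rcases near x y hx hy hxy with rfl | h1
    · rcases near x' y' hx' hy' hxy' with rfl | h2
      · exact absurd rfl hne
      · exact absurd (hsymm _ _ ▸ h2) hxx
    · exact h1
  have hxa' : adj x' a = true := by
    rcases near x' y' hx' hy' hxy' with rfl | h2
    · exact absurd hxa hxx
    · exact h2
  have trig : ∀ x y, σ x = true → σ y = false → adj x y = true →
      ∃ i < n, trigger adj b x (i, σ i) = true := by
    intro x y hx hy hxy
    by_cases hxb : adj x b = true
    · exact ⟨x, (hadj _ _ hxy).1, trigger_iff.2 (Or.inl ⟨hxb, by rw [hx]⟩)⟩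
    · exact ⟨y, (hadj _ _ hxy).2, trigger_iff.2 (Or.inr ⟨by simpa using hxb, hxy, hy⟩)⟩
  obtain ⟨i, hi, hti⟩ := trig x y hx hy hxy
  obtain ⟨j, hj, htj⟩ := trig x' y' hx' hy' hxy'
  have := h i hi j hj
  rw [← Bool.not_eq_true, halfClash_iff] at this
  refine this (Or.inr (Or.inr ⟨x, (hadj _ _ hxy).1, x', (hadj _ _ hxy').1, hne,
    by simpa using hxx, hxa, hxa', ?_, ?_, hti, htj⟩))
  · rintro rfl
    simp_all
  · rintro rfl
    simp_all

lemma halfClash_eq_false (hsymm : ∀ i j, adj i j = adj j i)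
    (hab : adj a b = true) (ha : σ a = true) (hb : σ b = false) (h : CutClique adj σ)
    (h' : CutClique adj fun i => !σ i) (i j : ℕ) :
    halfClash adj n a b (i, σ i) (j, σ j) = false := by
  rw [← Bool.not_eq_true, halfClash_iff]
  have bdry : ∀ x k, adj x a = true → x ≠ b → trigger adj b x (k, σ k) = true →
      σ x = true ∧ ∃ y, adj x y = true ∧ σ y = false := by
    intro x k hxa hxb ht
    rcases trigger_iff.1 ht with ⟨h1, h2⟩ | ⟨h1, h2, h3⟩
    · simp only [Prod.mk.injEq] at h2
      obtain ⟨rfl, h2⟩ := h2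
      exact ⟨h2, b, h1, hb⟩
    · refine ⟨?_, k, h2, h3⟩
      by_contra hx
      have := h' x b a a (by simpa using hx) (by simpa using hb) (by simpa using ha)
        (by simpa using ha) hxa (by rw [hsymm]; exact hab) hxb
      simp_all
  rintro (⟨h1, h2⟩ | ⟨h1, h2, h3, h4, h5⟩ |
    ⟨x, -, x', -, h1, h2, h3, h4, h5, h6, h7, h8⟩)
  · simp only [Prod.mk.injEq] at h1
    obtain ⟨rfl, h1⟩ := h1
    simp_all
  · have := h i a j b h1 ha h2 hb h3 hab h4
    simp_all
  · obtain ⟨hx, y, hxy, hy⟩ := bdry x i h3 h5 h7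
    obtain ⟨hx', y', hxy', hy'⟩ := bdry x' j h4 h6 h8
    have := h x x' y y' hx hx' hy hy' hxy hxy' h1
    simp_all

/-- The solutions of the system are the sets that contain `a` but not `b` and for which both sides
of the cut have a clique as boundary. -/
lemma clash_eq_false_iff (hadj : ∀ i j, adj i j = true → i < n ∧ j < n)
    (hsymm : ∀ i j, adj i j = adj j i) (hab : adj a b = true) :
    (∀ i < n, ∀ j < n, clash adj n a b (i, σ i) (j, σ j) = false) ↔
      σ a = true ∧ σ b = false ∧ CutClique adj σ ∧ CutClique adj fun i => !σ i := by
  have hba : adj b a = true := by rw [hsymm, hab]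
  constructor
  · intro h
    simp only [clash, Bool.or_eq_false_iff] at h
    have h1 : ∀ i < n, ∀ j < n, halfClash adj n a b (i, σ i) (j, σ j) = false :=
      fun i hi j hj => (h i hi j hj).1.1
    have h2 : ∀ i < n, ∀ j < n, halfClash adj n b a (i, !σ i) (j, !σ j) = false :=
      fun i hi j hj => (h i hi j hj).1.2
    have ha := eq_true_of_halfClash (hadj _ _ hab).1 h1
    have hb := eq_true_of_halfClash (σ := fun i => !σ i) (hadj _ _ hab).2 h2
    have hb' : σ b = false := by simpa using hb
    exact ⟨ha, hb', cutClique_of_halfClash hadj hsymm h1 hb',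
      cutClique_of_halfClash (σ := fun i => !σ i) hadj hsymm h2 (by simpa using ha)⟩
  · rintro ⟨ha, hb, h, h'⟩ i - j -
    have h1 := halfClash_eq_false (n := n) hsymm hab ha hb h h'
    have h2 := halfClash_eq_false (n := n) (σ := fun i => !σ i) hsymm hba (by simpa using hb)
      (by simpa using ha) h' (by simpa using h)
    simp only [clash, Bool.or_eq_false_iff]
    exact ⟨⟨h1 i j, h2 i j⟩, h1 j i, h2 j i⟩

end Clash

/-! ### Running programs -/

section Machine

/-- Renaming of the variables of an expression. -/
def Expr.rename (r : ℕ → ℕ) : Expr → Expr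
  | .var i => .var (r i)
  | .nil => .nil
  | .cons e f => .cons (e.rename r) (f.rename r)
  | .hd e => .hd (e.rename r)
  | .tl e => .tl (e.rename r)

/-- Renaming of the variables of a program. -/
def Program.rename (r : ℕ → ℕ) : Program → Program
  | .assign i e => .assign (r i) (e.rename r)
  | .seq c d => .seq (c.rename r) (d.rename r)
  | .ite e c d => .ite (e.rename r) (c.rename r) (d.rename r)
  | .loop e c => .loop (e.rename r) (c.rename r)

lemma Expr.cost_rename (r : ℕ → ℕ) (e : Expr) : (e.rename r).cost = e.cost := by
  induction e <;> simp_all [Expr.rename, Expr.cost]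

lemma Expr.val_rename (r : ℕ → ℕ) (e : Expr) (s : Store) :
    (e.rename r).val s = e.val (s ∘ r) := by
  induction e <;> simp_all [Expr.rename, Expr.val]

lemma Exec.rename {r : ℕ → ℕ} (hr : r.Injective) {c : Program} {s s' : Store} {t : ℕ}
    (h : Exec c s t s') : ∀ σ : Store, σ ∘ r = s →
      ∃ σ', Exec (c.rename r) σ t σ' ∧ σ' ∘ r = s' ∧ ∀ i ∉ Set.range r, σ' i = σ i := by
  induction h with
  | assign i e s =>
    rintro σ rfl
    refine ⟨_, Expr.cost_rename r e ▸ Exec.assign (r i) (e.rename r) σ, ?_, ?_⟩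
    · rw [Function.update_comp_eq_of_injective _ hr, Expr.val_rename]
    · intro j hj
      rw [Function.update_of_ne]
      rintro rfl
      exact hj ⟨i, rfl⟩
  | seq _ _ ih₁ ih₂ =>
    intro σ hσ
    obtain ⟨σ₁, h1, h2, h3⟩ := ih₁ σ hσ
    obtain ⟨σ₂, h4, h5, h6⟩ := ih₂ σ₁ h2
    exact ⟨σ₂, .seq h1 h4, h5, fun i hi => (h6 i hi).trans (h3 i hi)⟩
  | @ite_true e _ _ _ _ _ he _ ih =>
    rintro σ rfl
    obtain ⟨σ₁, h1, h2, h3⟩ := ih σ rfl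
    exact ⟨σ₁, Expr.cost_rename r e ▸ .ite_true (by rwa [Expr.val_rename]) h1, h2, h3⟩
  | @ite_false e _ _ _ _ _ he _ ih =>
    rintro σ rfl
    obtain ⟨σ₁, h1, h2, h3⟩ := ih σ rfl
    exact ⟨σ₁, Expr.cost_rename r e ▸ .ite_false (by rwa [Expr.val_rename]) h1, h2, h3⟩
  | @loop_true e _ _ _ _ _ _ he _ _ ih₁ ih₂ =>
    rintro σ rfl
    obtain ⟨σ₁, h1, h2, h3⟩ := ih₁ σ rfl
    obtain ⟨σ₂, h4, h5, h6⟩ := ih₂ σ₁ h2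
    exact ⟨σ₂, Expr.cost_rename r e ▸ .loop_true (by rwa [Expr.val_rename]) h1 h4, h5,
      fun i hi => (h6 i hi).trans (h3 i hi)⟩
  | @loop_false e _ _ he =>
    rintro σ rfl
    exact ⟨σ, Expr.cost_rename r e ▸ .loop_false (by rwa [Expr.val_rename]), rfl, fun _ _ => rfl⟩

/-- Started in the store `s`, the program `c` halts within `T` steps in a store satisfying `Q`. -/
def Runs (c : Program) (s : Store) (T : ℕ) (Q : Store → Prop) : Prop :=
  ∃ t s', t ≤ T ∧ Exec c s t s' ∧ Q s'

namespace Runs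

variable {c c₁ c₂ : Program} {s : Store} {T T₁ T₂ : ℕ} {P Q : Store → Prop}

lemma mono (h : Runs c s T₁ P) (hT : T₁ ≤ T₂) (hQ : ∀ s', P s' → Q s') : Runs c s T₂ Q := by
  obtain ⟨t, s', ht, he, hp⟩ := h
  exact ⟨t, s', ht.trans hT, he, hQ _ hp⟩

lemma assign {i : ℕ} {e : Expr} (h : Q (Function.update s i (e.val s))) :
    Runs (.assign i e) s (e.cost + 1) Q :=
  ⟨_, _, le_rfl, .assign i e s, h⟩

lemma seq (h : Runs c₁ s T₁ fun s' => Runs c₂ s' T₂ Q) : Runs (.seq c₁ c₂) s (T₁ + T₂) Q := by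
  obtain ⟨t₁, s₁, ht₁, he₁, t₂, s₂, ht₂, he₂, hQ⟩ := h
  exact ⟨_, _, add_le_add ht₁ ht₂, .seq he₁ he₂, hQ⟩

lemma ite {e : Expr} (h₁ : e.val s ≠ .nil → Runs c₁ s T Q) (h₂ : e.val s = .nil → Runs c₂ s T Q) :
    Runs (.ite e c₁ c₂) s (e.cost + 1 + T) Q := by
  by_cases he : e.val s = .nil
  · obtain ⟨t, s', ht, hx, hQ⟩ := h₂ he
    exact ⟨_, _, add_le_add le_rfl ht, .ite_false he hx, hQ⟩
  · obtain ⟨t, s', ht, hx, hQ⟩ := h₁ he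
    exact ⟨_, _, add_le_add le_rfl ht, .ite_true he hx, hQ⟩

end Runs

/-- A type whose elements are represented by trees. -/
class Coded (α : Type) where
  /-- The tree representing an element. -/
  code : α → Data

open Coded

instance : Coded Unit := ⟨fun _ => .nil⟩

instance : Coded Bool := ⟨Data.ofBool⟩

instance {α β : Type} [Coded α] [Coded β] : Coded (α × β) := ⟨fun x => .cons (code x.1) (code x.2)⟩

instance {α : Type} [Coded α] : Coded (List α) := ⟨fun l => Data.ofList (l.map code)⟩

/-- Natural numbers are represented in unary. -/
instance : Coded ℕ := ⟨fun n => code (List.replicate n ())⟩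

/-- The number of nodes of a tree. -/
def Data.size : Data → ℕ
  | .nil => 1
  | .cons x y => x.size + y.size + 1

/-- The number of nodes of the tree representing an element. -/
def size {α : Type} [Coded α] (a : α) : ℕ := (code a).size

variable {α β γ δ : Type} [Coded α] [Coded β] [Coded γ] [Coded δ]

@[simp]
lemma code_nil : code ([] : List α) = .nil := rfl

@[simp]
lemma code_cons (a : α) (l : List α) : code (a :: l) = .cons (code a) (code l) := rfl

@[simp]
lemma code_prod (a : α) (b : β) : code (a, b) = .cons (code a) (code b) := rfl

@[simp]
lemma code_true : code true = .cons .nil .nil := rfl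

@[simp]
lemma code_false : code false = .nil := rfl

@[simp]
lemma code_zero : code (0 : ℕ) = .nil := rfl

@[simp]
lemma code_succ (n : ℕ) : code (n + 1) = .cons .nil (code n) := rfl

@[simp]
lemma size_nil : size ([] : List α) = 1 := rfl

@[simp]
lemma size_cons (a : α) (l : List α) : size (a :: l) = size a + size l + 1 := rfl

@[simp]
lemma size_prod (a : α) (b : β) : size (a, b) = size a + size b + 1 := rfl

lemma size_nat (n : ℕ) : size n = 2 * n + 1 := by
  induction n with
  | zero => rfl
  | succ n ih =>
    change Data.size .nil + size n + 1 = _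
    rw [ih]
    simp [Data.size]
    ring

lemma size_bool_le (b : Bool) : size b ≤ 3 := by
  cases b <;> decide

lemma length_le_size (l : List α) : l.length ≤ size l := by
  induction l with
  | nil => simp
  | cons a l ih =>
    simp only [List.length_cons, size_cons]
    omega

lemma size_append (l l' : List α) : size (l ++ l') + 1 = size l + size l' := by
  induction l with
  | nil => simp [add_comm]
  | cons a l ih =>
    simp only [List.cons_append, size_cons]
    omega

lemma size_reverse (l : List α) : size l.reverse = size l := by
  induction l with
  | nil => rfl
  | cons a l ih =>
    have := size_append l.reverse [a]
    simp only [List.reverse_cons, size_cons, size_nil] at this ⊢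
    omega

lemma size_le_of_sublist {l l' : List α} (h : List.Sublist l l') : size l ≤ size l' := by
  induction h with
  | slnil => rfl
  | cons a _ ih =>
    rw [size_cons]
    omega
  | cons_cons a _ ih =>
    simp only [size_cons]
    omega

lemma size_le_of_mem {a : α} {l : List α} (h : a ∈ l) : size a ≤ size l := by
  induction l with
  | nil => simp at h
  | cons b l ih =>
    rw [size_cons]
    rcases List.mem_cons.1 h with rfl | h
    · omega
    · have := ih h
      omega

/-- A loop that takes the list stored in the variable `k` apart; `I l` is the loop invariant when
the elements of `l` are still to be processed. -/
lemma Runs.loop {k : ℕ} {body : Program} {T : ℕ} (I : List β → Store → Prop)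
    (hk : ∀ l s, I l s → s k = code l)
    (hbody : ∀ b l s, I (b :: l) s → Runs body s T (I l)) (l : List β) (s : Store) (hs : I l s) :
    Runs (.loop (.var k) body) s (l.length * (T + 2) + 2) (I []) := by
  induction l generalizing s with
  | nil =>
    exact ⟨_, _, by simp [Expr.cost], .loop_false (by simp [Expr.val, hk _ _ hs]), hs⟩
  | cons b l ih =>
    obtain ⟨t₁, s₁, ht₁, he₁, h₁⟩ := hbody b l s hs
    obtain ⟨t₂, s₂, ht₂, he₂, h₂⟩ := ih s₁ h₁
    refine ⟨_, _, ?_, .loop_true (by simp [Expr.val, hk _ _ hs]) he₁ he₂, h₂⟩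
    simp only [Expr.cost, List.length_cons]
    nlinarith

/-! ### Polynomial-time functions -/

lemma eval_mono (p : Polynomial ℕ) {x y : ℕ} (h : x ≤ y) : p.eval x ≤ p.eval y := by
  simp only [Polynomial.eval_eq_sum, Polynomial.sum]
  gcongr

/-- The program `c` computes the function `f` from the variable `X₀` to the variable `X₀`, whatever
the other variables contain; the polynomial `p` bounds both the running time and the size of
the result. -/
def ComputesIn (c : Program) (p : Polynomial ℕ) (f : α → β) : Prop :=
  ∀ a, size (f a) ≤ p.eval (size a) ∧
    ∀ s : Store, s 0 = code a → Runs c s (p.eval (size a)) fun s' => s' 0 = code (f a)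

/-- The function `f` is computable in polynomial time. -/
def PolyTime (f : α → β) : Prop := ∃ c p, ComputesIn c p f

/-- The subprogram that evaluates `c` at the value of `e`. It works on the odd variables only and
leaves the result in the variable `X₁`. -/
def Program.call (c : Program) (e : Expr) : Program :=
  .seq (.assign 1 e) (c.rename fun i => 2 * i + 1)

lemma ComputesIn.call {c : Program} {p : Polynomial ℕ} {f : α → β} (h : ComputesIn c p f)
    {e : Expr} {s : Store} {a : α} (he : e.val s = code a) :
    Runs (c.call e) s (e.cost + 1 + p.eval (size a)) fun s' =>
      s' 1 = code (f a) ∧ ∀ i, s' (2 * i) = s (2 * i) := by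
  refine .seq (.assign ?_)
  set s₁ := Function.update s 1 (e.val s) with hs₁
  obtain ⟨t, s', ht, hx, hs'⟩ := (h a).2 (s₁ ∘ fun i => 2 * i + 1) (by simp [hs₁, he])
  obtain ⟨σ, hσ, h1, h2⟩ := hx.rename (r := fun i => 2 * i + 1)
    (fun i j hij => by simpa using hij) s₁ rfl
  refine ⟨t, σ, ht, hσ, ?_, fun i => ?_⟩
  · rw [← hs', ← h1]
    rfl
  · rw [h2 _ (by rintro ⟨j, hj⟩; dsimp only at hj; omega), hs₁,
      Function.update_of_ne (by omega)]

/-- An expression denoting a fixed tree. -/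
def Expr.ofData : Data → Expr
  | .nil => .nil
  | .cons x y => .cons (Expr.ofData x) (Expr.ofData y)

lemma Expr.val_ofData (s : Store) (x : Data) : (Expr.ofData x).val s = x := by
  induction x <;> simp_all [Expr.ofData, Expr.val]

namespace PolyTime

lemma of_expr {f : α → β} (e : Expr) (p : Polynomial ℕ)
    (he : ∀ a (s : Store), s 0 = code a → e.val s = code (f a))
    (hp : ∀ a, size (f a) ≤ p.eval (size a)) : PolyTime f := by
  refine ⟨.assign 0 e, p + Polynomial.C (e.cost + 1), fun a => ⟨?_, fun s hs => ?_⟩⟩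
  · have := hp a
    simp only [Polynomial.eval_add, Polynomial.eval_C]
    omega
  · refine Runs.mono (Runs.assign (Q := fun s' => s' 0 = code (f a)) ?_) ?_ fun _ h => h
    · simp [he a s hs]
    · simp

lemma const (b : β) : PolyTime fun _ : α => b :=
  of_expr (.ofData (code b)) (Polynomial.C (size b)) (fun _ _ _ => Expr.val_ofData _ _) (by simp)

lemma fst' : PolyTime fun x : α × β => x.1 :=
  of_expr (.hd (.var 0)) Polynomial.X (fun x s h => by simp [Expr.val, h, code, Data.hd])
    (fun x => by
      have : size x = size x.1 + size x.2 + 1 := size_prod x.1 x.2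
      simp only [Polynomial.eval_X]
      omega)

lemma snd' : PolyTime fun x : α × β => x.2 :=
  of_expr (.tl (.var 0)) Polynomial.X (fun x s h => by simp [Expr.val, h, code, Data.tl])
    (fun x => by
      have : size x = size x.1 + size x.2 + 1 := size_prod x.1 x.2
      simp only [Polynomial.eval_X]
      omega)

lemma comp {g : β → γ} {f : α → β} (hg : PolyTime g) (hf : PolyTime f) :
    PolyTime fun a => g (f a) := by
  obtain ⟨c, p, hc⟩ := hf
  obtain ⟨d, q, hd⟩ := hg
  refine ⟨.seq c d, p + q.comp p, fun a => ⟨?_, fun s hs => ?_⟩⟩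
  · have h1 := (hd (f a)).1
    have h2 := eval_mono q (hc a).1
    simp only [Polynomial.eval_add, Polynomial.eval_comp]
    omega
  · simp only [Polynomial.eval_add, Polynomial.eval_comp]
    refine .seq (((hc a).2 s hs).mono le_rfl fun s' h => ?_)
    exact ((hd (f a)).2 s' h).mono (eval_mono q (hc a).1) fun _ h => h

lemma fst {f : α → β × γ} (hf : PolyTime f) : PolyTime fun a => (f a).1 := fst'.comp hf

lemma snd {f : α → β × γ} (hf : PolyTime f) : PolyTime fun a => (f a).2 := snd'.comp hf

lemma pair {f : α → β} {g : α → γ} (hf : PolyTime f) (hg : PolyTime g) :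
    PolyTime fun a => (f a, g a) := by
  obtain ⟨c, p, hc⟩ := hf
  obtain ⟨d, q, hd⟩ := hg
  refine ⟨.seq (c.call (.var 0)) (.seq (.assign 2 (.var 1)) (.seq (d.call (.var 0))
    (.assign 0 (.cons (.var 2) (.var 1))))), p + q + Polynomial.C 20, fun a => ⟨?_, fun s hs => ?_⟩⟩
  · have h1 := (hc a).1
    have h2 := (hd a).1
    simp only [Polynomial.eval_add, Polynomial.eval_C, size_prod]
    omega
  · refine Runs.mono (.seq ((hc.call (e := .var 0) hs).mono le_rfl ?_))
      (T₁ := 1 + 1 + p.eval (size a) + (1 + 1 + (1 + 1 + q.eval (size a) + (3 + 1)))) ?_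
      fun _ h => h
    · rintro s₁ ⟨h1, h2⟩
      refine .seq (.assign (.seq ((hd.call (e := .var 0) (a := a) ?_).mono le_rfl ?_)))
      · simpa [Expr.val] using (h2 0).trans hs
      · rintro s₂ ⟨h3, h4⟩
        refine .assign ?_
        have h5 := h4 1
        simp only [Expr.val, Function.update_self, mul_one] at h5 ⊢
        rw [h3, h5, h1]
        rfl
    · simp only [Polynomial.eval_add, Polynomial.eval_C]
      omega

lemma ite {b : α → Bool} {f g : α → β} (hb : PolyTime b) (hf : PolyTime f) (hg : PolyTime g) :
    PolyTime fun a => if b a then f a else g a := by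
  obtain ⟨cb, pb, hcb⟩ := hb
  obtain ⟨c, p, hc⟩ := hf
  obtain ⟨d, q, hd⟩ := hg
  refine ⟨.seq (cb.call (.var 0)) (.ite (.var 1) c d), pb + p + q + Polynomial.C 20,
    fun a => ⟨?_, fun s hs => ?_⟩⟩
  · have h1 := (hc a).1
    have h2 := (hd a).1
    simp only [Polynomial.eval_add, Polynomial.eval_C]
    split <;> omega
  · refine Runs.mono (.seq ((hcb.call (e := .var 0) hs).mono le_rfl ?_))
      (T₁ := 1 + 1 + pb.eval (size a) + (1 + 1 + (p.eval (size a) + q.eval (size a)))) ?_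
      fun _ h => h
    · rintro s₁ ⟨h1, h2⟩
      have h3 : s₁ 0 = code a := (h2 0).trans hs
      refine .ite (fun h => ?_) (fun h => ?_)
      · have hb : b a = true := by
          by_contra hb
          simp only [Bool.not_eq_true] at hb
          simp [Expr.val, h1, hb] at h
        simp only [hb, if_true]
        exact ((hc a).2 s₁ h3).mono (by omega) fun _ h => h
      · have hb : b a = false := by
          by_contra hb
          simp only [Bool.not_eq_false] at hb
          simp [Expr.val, h1, hb] at h
        simp only [hb]
        exact ((hd a).2 s₁ h3).mono (by omega) fun _ h => h
    · simp only [Polynomial.eval_add, Polynomial.eval_C]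
      omega

/-- Iteration over a list, provided that the intermediate results stay small. -/
lemma foldl {l : δ → List β} {i : δ → γ} {g : δ → γ → β → γ} (hl : PolyTime l) (hi : PolyTime i)
    (hg : PolyTime fun x : (δ × γ) × β => g x.1.1 x.1.2 x.2) (r : Polynomial ℕ)
    (hr : ∀ d l', l' <+: l d → size (l'.foldl (g d) (i d)) ≤ r.eval (size d)) :
    PolyTime fun d => (l d).foldl (g d) (i d) := by
  obtain ⟨cl, pl, hcl⟩ := hl
  obtain ⟨ci, pi, hci⟩ := hi
  obtain ⟨c, p, hc⟩ := hg
  let body : Program := .seq (c.call (.cons (.cons (.var 0) (.var 4)) (.hd (.var 2))))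
    (.seq (.assign 4 (.var 1)) (.assign 2 (.tl (.var 2))))
  let B : Polynomial ℕ := p.comp (Polynomial.X + r + pl + 2) + Polynomial.C 20
  refine ⟨.seq (cl.call (.var 0)) (.seq (.assign 2 (.var 1)) (.seq (ci.call (.var 0))
    (.seq (.assign 4 (.var 1)) (.seq (.loop (.var 2) body) (.assign 0 (.var 4)))))),
    pl + pi + r + pl * B + Polynomial.C 40, fun d => ⟨?_, fun s hs => ?_⟩⟩
  · have h1 := hr d (l d) (List.prefix_refl _)
    simp only [Polynomial.eval_add, Polynomial.eval_mul, Polynomial.eval_C]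
    omega
  set T := p.eval (size d + r.eval (size d) + pl.eval (size d) + 2) + 18 with hT
  -- the processed elements form a prefix of the list, and the accumulator is in the variable 4
  let I : List β → Store → Prop := fun m s => s 0 = code d ∧ s 2 = code m ∧
    ∃ l', l d = l' ++ m ∧ s 4 = code (l'.foldl (g d) (i d))
  have hlen : (l d).length ≤ pl.eval (size d) := (length_le_size _).trans (hcl d).1
  have hbody : ∀ b m s, I (b :: m) s → Runs body s T (I m) := by
    rintro b m s ⟨h0, h2, l', hl', h4⟩
    have hsz : size ((d, l'.foldl (g d) (i d)), b) ≤
        size d + r.eval (size d) + pl.eval (size d) + 2 := by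
      have h1 := hr d l' ⟨_, hl'.symm⟩
      have h2 : size b ≤ size (l d) := size_le_of_mem (by simp [hl'])
      have h3 := (hcl d).1
      simp only [size_prod]
      omega
    refine Runs.mono (.seq ((hc.call (a := ((d, l'.foldl (g d) (i d)), b)) ?_).mono le_rfl ?_))
      (T₁ := 7 + p.eval (size ((d, l'.foldl (g d) (i d)), b)) + (1 + 1 + (2 + 1))) ?_ fun _ h => h
    · simp [Expr.val, h0, h2, h4, Data.hd]
    · rintro s₁ ⟨h5, h6⟩
      refine .seq (.assign (.assign ⟨?_, ?_, l' ++ [b], by simp [hl'], ?_⟩))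
      · simpa using (h6 0).trans h0
      · have := (h6 1).trans h2
        simp only [mul_one] at this
        simp [Expr.val, this, Data.tl]
      · simp [Expr.val, h5]
    · have := eval_mono p hsz
      omega
  refine Runs.mono (.seq ((hcl.call (e := .var 0) hs).mono le_rfl ?_))
    (T₁ := 1 + 1 + pl.eval (size d) + (1 + 1 + (1 + 1 + pi.eval (size d) +
      (1 + 1 + ((l d).length * (T + 2) + 2 + (1 + 1)))))) ?_ fun _ h => h
  · rintro s₁ ⟨h1, h2⟩
    refine .seq (.assign (.seq ((hci.call (e := .var 0) (a := d) ?_).mono le_rfl ?_)))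
    · simpa [Expr.val] using (h2 0).trans hs
    · rintro s₂ ⟨h3, h4⟩
      refine .seq (.assign (.seq ((Runs.loop I (fun _ _ h => h.2.1) hbody (l d) _ ?_).mono
        le_rfl ?_)))
      · refine ⟨?_, ?_, [], rfl, ?_⟩
        · have := h4 0
          simp only [mul_zero] at this
          simpa [this] using (h2 0).trans hs
        · have := h4 1
          simp only [mul_one] at this
          simp [this, Expr.val, h1]
        · simp [Expr.val, h3]
      · rintro s₃ ⟨-, -, l', hl', h5⟩
        refine .assign ?_
        simp only [Expr.val, Function.update_self, h5]
        rw [hl', List.append_nil]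
  · have h1 : (l d).length * (T + 2) ≤ pl.eval (size d) * (T + 2) := by gcongr
    have h2 : (pl * B).eval (size d) = pl.eval (size d) * (T + 2) := by
      simp [B, hT]
    simp only [Polynomial.eval_add, h2, Polynomial.eval_C]
    omega

end PolyTime

end Machine

open Coded

namespace PolyTime

variable {α β γ δ : Type} [Coded α] [Coded β] [Coded γ] [Coded δ]

lemma congr {f g : α → β} (hf : PolyTime f) (h : ∀ a, f a = g a) : PolyTime g :=
  funext h ▸ hf

lemma exists_size_le {f : α → β} (hf : PolyTime f) :
    ∃ p : Polynomial ℕ, ∀ a, size (f a) ≤ p.eval (size a) := by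
  obtain ⟨c, p, h⟩ := hf
  exact ⟨p, fun a => (h a).1⟩

/-! ### Truth values -/

section Bool

variable {f g : α → Bool}

lemma not (hf : PolyTime f) : PolyTime fun a => !f a :=
  (hf.ite (const false) (const true)).congr fun a => by cases f a <;> rfl

lemma and (hf : PolyTime f) (hg : PolyTime g) : PolyTime fun a => f a && g a :=
  (hf.ite hg (const false)).congr fun a => by cases f a <;> rfl

lemma or (hf : PolyTime f) (hg : PolyTime g) : PolyTime fun a => f a || g a :=
  (hf.ite (const true) hg).congr fun a => by cases f a <;> rfl

lemma beq_bool (hf : PolyTime f) (hg : PolyTime g) : PolyTime fun a => f a == g a :=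
  (hf.ite hg hg.not).congr fun a => by cases f a <;> cases g a <;> rfl

end Bool

/-! ### Lists and numbers -/

lemma cons {f : δ → α} {l : δ → List α} (hf : PolyTime f) (hl : PolyTime l) :
    PolyTime fun d => f d :: l d :=
  PolyTime.comp (g := fun x : α × List α => x.1 :: x.2)
    (of_expr (.var 0) Polynomial.X (fun _ _ h => h) fun x => by
      simp only [Polynomial.eval_X]
      rfl) (hf.pair hl)

lemma tail {l : δ → List α} (hl : PolyTime l) : PolyTime fun d => (l d).tail :=
  PolyTime.comp (g := fun l : List α => l.tail)
    (of_expr (.tl (.var 0)) Polynomial.X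
      (fun l s h => by cases l <;> simp [Expr.val, h, Data.tl])
      fun l => by
        rw [Polynomial.eval_X]
        exact size_le_of_sublist l.tail_sublist) hl

lemma headD {l : δ → List α} {f : δ → α} (hl : PolyTime l) (hf : PolyTime f) :
    PolyTime fun d => (l d).headD (f d) := by
  refine PolyTime.comp (g := fun x : List α × α => x.1.headD x.2) ?_ (hl.pair hf)
  refine ⟨.ite (.hd (.var 0)) (.assign 0 (.hd (.hd (.var 0)))) (.assign 0 (.tl (.var 0))),
    Polynomial.X + Polynomial.C 7, ?_⟩
  rintro ⟨l, a⟩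
  refine ⟨?_, fun s hs => ?_⟩
  · cases l <;> simp <;> omega
  · refine Runs.mono (.ite (T := 4) (fun h => ?_) fun h => ?_) (by simp [Expr.cost]) fun _ h => h
    · refine .assign ?_
      cases l
      · simp [Expr.val, hs, Data.hd] at h
      · simp [Expr.val, hs, Data.hd]
    · refine Runs.mono (.assign (Q := fun s' => s' 0 = code (l.headD a)) ?_) (by simp [Expr.cost])
        fun _ h => h
      cases l
      · simp [Expr.val, hs, Data.tl]
      · simp [Expr.val, hs, Data.hd] at h

lemma isEmpty {l : δ → List α} (hl : PolyTime l) : PolyTime fun d => (l d).isEmpty := by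
  refine PolyTime.comp (g := fun l : List α => l.isEmpty) ?_ hl
  refine ⟨.ite (.var 0) (.assign 0 .nil) (.assign 0 (.cons .nil .nil)), Polynomial.C 6,
    fun l => ⟨(size_bool_le _).trans (by simp), fun s hs => ?_⟩⟩
  refine Runs.mono (.ite (T := 4) (fun h => ?_) fun h => ?_) (by simp [Expr.cost]) fun _ h => h
  · refine Runs.mono (.assign (Q := fun s' => s' 0 = code l.isEmpty) ?_) (by simp [Expr.cost])
      fun _ h => h
    cases l
    · simp [Expr.val, hs] at h
    · simp [Expr.val]
  · refine .assign ?_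
    cases l
    · simp [Expr.val]
    · simp [Expr.val, hs] at h

lemma foldl_cons_eq {α : Type} (l l' : List α) :
    l.foldl (fun acc b => b :: acc) l' = l.reverse ++ l' := by
  induction l generalizing l' with
  | nil => rfl
  | cons a l ih => simp [ih]

lemma reverse {l : δ → List α} (hl : PolyTime l) : PolyTime fun d => (l d).reverse := by
  obtain ⟨p, hp⟩ := hl.exists_size_le
  refine (PolyTime.foldl (i := fun _ => []) (g := fun _ acc b => b :: acc) hl (const [])
    (snd'.cons fst'.snd) p fun d l' h => ?_).congr fun d => by simp
  rw [foldl_cons_eq, List.append_nil, size_reverse]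
  exact (size_le_of_sublist h.sublist).trans (hp d)

lemma append {l l' : δ → List α} (hl : PolyTime l) (hl' : PolyTime l') :
    PolyTime fun d => l d ++ l' d := by
  obtain ⟨p, hp⟩ := hl.exists_size_le
  obtain ⟨p', hp'⟩ := hl'.exists_size_le
  refine (PolyTime.foldl (g := fun _ acc b => b :: acc) hl.reverse hl'
    (snd'.cons fst'.snd) (p + p') fun d m h => ?_).congr fun d => by simp
  rw [foldl_cons_eq, Polynomial.eval_add]
  have h1 := size_append m.reverse (l' d)
  have h2 := size_le_of_sublist h.sublist
  have h3 := hp d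
  have h4 := hp' d
  rw [size_reverse] at h1 h2
  omega

lemma units {n : δ → ℕ} (hn : PolyTime n) : PolyTime fun d => List.replicate (n d) () :=
  PolyTime.comp (g := fun n : ℕ => List.replicate n ())
    (of_expr (.var 0) Polynomial.X (fun _ _ h => h) fun n => by
      simp only [Polynomial.eval_X]
      rfl) hn

lemma succ {n : δ → ℕ} (hn : PolyTime n) : PolyTime fun d => n d + 1 :=
  PolyTime.comp (g := fun n : ℕ => n + 1)
    (of_expr (.cons .nil (.var 0)) (Polynomial.X + Polynomial.C 2)
      (fun _ _ h => by simp [Expr.val, h]) fun n => by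
        simp [size_nat]
        omega) hn

lemma pred {n : δ → ℕ} (hn : PolyTime n) : PolyTime fun d => n d - 1 :=
  PolyTime.comp (g := fun n : ℕ => n - 1)
    (of_expr (.tl (.var 0)) Polynomial.X
      (fun n _ h => by cases n <;> simp [Expr.val, h, Data.tl]) fun n => by
        simp [size_nat]) hn

lemma length {l : δ → List α} (hl : PolyTime l) : PolyTime fun d => (l d).length := by
  have key : ∀ l : List α, l.foldl (fun n _ => n + 1) 0 = l.length := fun l => by
    simp
  obtain ⟨p, hp⟩ := hl.exists_size_le
  refine (PolyTime.foldl (i := fun _ => 0) (g := fun _ n _ => n + 1) hl (const 0)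
    fst'.snd.succ (2 * p + 1) fun d m h => ?_).congr fun d => key _
  rw [key, size_nat]
  have h1 := length_le_size m
  have h2 := size_le_of_sublist h.sublist
  have h3 := hp d
  simp only [Polynomial.eval_add, Polynomial.eval_mul, Polynomial.eval_ofNat, Polynomial.eval_one]
  omega

lemma sub {m n : δ → ℕ} (hm : PolyTime m) (hn : PolyTime n) : PolyTime fun d => m d - n d := by
  have key : ∀ (l : List Unit) (m : ℕ), l.foldl (fun m _ => m - 1) m = m - l.length := by
    intro l
    induction l with
    | nil => exact fun _ => rfl
    | cons a l ih =>
      intro m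
      simp only [List.foldl_cons, ih, List.length_cons]
      omega
  obtain ⟨p, hp⟩ := hm.exists_size_le
  refine (PolyTime.foldl (g := fun _ m _ => m - 1) hn.units hm fst'.snd.pred p
    fun d l _ => ?_).congr fun d => by rw [key, List.length_replicate]
  have := hp d
  rw [size_nat] at this
  rw [key, size_nat]
  omega

lemma beq_nat {m n : δ → ℕ} (hm : PolyTime m) (hn : PolyTime n) :
    PolyTime fun d => m d == n d :=
  ((hm.sub hn).units.isEmpty.and (hn.sub hm).units.isEmpty).congr fun d => by
    rw [Bool.eq_iff_iff]
    simp only [Bool.and_eq_true, List.isEmpty_iff, List.replicate_eq_nil_iff, beq_iff_eq]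
    omega

lemma beq_literal {l l' : δ → ℕ × Bool} (hl : PolyTime l) (hl' : PolyTime l') :
    PolyTime fun d => l d == l' d :=
  (beq_nat hl.fst hl'.fst).and (beq_bool hl.snd hl'.snd)

lemma drop {n : δ → ℕ} {l : δ → List α} (hn : PolyTime n) (hl : PolyTime l) :
    PolyTime fun d => (l d).drop (n d) := by
  have key : ∀ (m : List Unit) (l : List α), m.foldl (fun l _ => l.tail) l = l.drop m.length := by
    intro m
    induction m with
    | nil => exact fun _ => rfl
    | cons a m ih =>
      intro l
      simp [ih]
  obtain ⟨p, hp⟩ := hl.exists_size_le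
  refine (PolyTime.foldl (g := fun _ l _ => l.tail) hn.units hl fst'.snd.tail p
    fun d l _ => ?_).congr fun d => by rw [key, List.length_replicate]
  rw [key]
  exact (size_le_of_sublist (List.drop_sublist _ _)).trans (hp d)

lemma getD {n : δ → ℕ} {l : δ → List α} {f : δ → α} (hl : PolyTime l) (hn : PolyTime n)
    (hf : PolyTime f) : PolyTime fun d => (l d).getD (n d) (f d) :=
  ((hn.drop hl).headD hf).congr fun d => by
    rw [List.headD_eq_head?_getD, List.head?_drop, List.getD_eq_getElem?_getD]

lemma any {l : δ → List β} {f : δ → β → Bool} (hl : PolyTime l)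
    (hf : PolyTime fun x : δ × β => f x.1 x.2) : PolyTime fun d => (l d).any (f d) := by
  have key : ∀ (f : β → Bool) (l : List β) (b : Bool),
      l.foldl (fun b x => b || f x) b = (b || l.any f) := by
    intro f l
    induction l with
    | nil => simp
    | cons x l ih =>
      intro b
      rw [List.foldl_cons, ih, List.any_cons, Bool.or_assoc]
  exact (PolyTime.foldl (i := fun _ => false) (g := fun d b x => b || f d x) hl (const false)
    (fst'.snd.or (hf.comp (fst'.fst.pair snd'))) (Polynomial.C 3) fun d m _ =>
      (size_bool_le _).trans (by simp)).congr fun d => by rw [key, Bool.false_or]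

lemma all {l : δ → List β} {f : δ → β → Bool} (hl : PolyTime l)
    (hf : PolyTime fun x : δ × β => f x.1 x.2) : PolyTime fun d => (l d).all (f d) :=
  (PolyTime.any (f := fun d b => !f d b) hl hf.not).not.congr fun d => by
    rw [List.all_eq_not_any_not]

lemma filter {l : δ → List β} {f : δ → β → Bool} (hl : PolyTime l)
    (hf : PolyTime fun x : δ × β => f x.1 x.2) : PolyTime fun d => (l d).filter (f d) := by
  have key : ∀ (f : β → Bool) (l : List β),
      l.foldl (fun acc x => if f x then x :: acc else acc) [] = l.reverse.filter f := by
    intro f l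
    rw [← List.foldr_reverse]
    generalize l.reverse = l
    induction l with
    | nil => rfl
    | cons x l ih => rw [List.foldr_cons, ih, List.filter_cons]
  obtain ⟨p, hp⟩ := hl.exists_size_le
  refine (PolyTime.foldl (i := fun _ => []) (g := fun d acc x => if f d x then x :: acc else acc)
    hl.reverse (const []) ((hf.comp (fst'.fst.pair snd')).ite (snd'.cons fst'.snd) fst'.snd) p
    fun d m h => ?_).congr fun d => by rw [key, List.reverse_reverse]
  rw [key]
  have h1 := size_le_of_sublist (List.filter_sublist (p := f d) (l := m.reverse))
  have h2 := size_le_of_sublist h.sublist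
  have h3 := hp d
  rw [size_reverse] at h1 h2
  omega

lemma range {n : δ → ℕ} (hn : PolyTime n) : PolyTime fun d => List.range (n d) := by
  have key : ∀ k, (List.replicate k ()).foldl (fun acc _ => acc ++ [acc.length]) [] =
      List.range k := by
    intro k
    induction k with
    | zero => rfl
    | succ k ih =>
      rw [List.replicate_succ', List.foldl_append, ih, List.range_succ]
      simp
  have hsize : ∀ k, size (List.range k) ≤ 1 + k * (2 * k + 2) := by
    intro k
    induction k with
    | zero => simp
    | succ k ih =>
      have := size_append (List.range k) [k]
      simp only [size_cons, size_nil, size_nat] at this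
      rw [List.range_succ]
      nlinarith
  obtain ⟨p, hp⟩ := hn.exists_size_le
  refine (PolyTime.foldl (i := fun _ => []) (g := fun _ acc _ => acc ++ [acc.length]) hn.units
    (const []) (fst'.snd.append (fst'.snd.length.cons (const []))) (1 + p * (2 * p + 2))
    fun d m h => ?_).congr fun d => key _
  have hm : m = List.replicate m.length () := List.eq_replicate_of_mem fun _ _ => rfl
  rw [hm, key]
  have h1 : m.length ≤ n d := by simpa using h.length_le
  have h2 := hp d
  rw [size_nat] at h2
  have h3 : m.length ≤ p.eval (size d) := by omega
  refine (hsize _).trans ?_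
  simp only [Polynomial.eval_add, Polynomial.eval_mul, Polynomial.eval_ofNat, Polynomial.eval_one]
  gcongr

end PolyTime

/-! ### Testing whether a partial set extends to a halfspace -/

/-- The entry `(i, j)` of an adjacency matrix. -/
def entry (M : List (List Bool)) (i j : ℕ) : Bool := (M.getD i []).getD j false

/-- Decides whether the partial characteristic vector `q` extends to a halfspace of the graph with
adjacency matrix `M`: either to the empty set or to the set of all vertices, or to a halfspace
that separates the ends of some edge. -/
def extendable (M : List (List Bool)) (q : List Bool) : Bool :=
  (q.all fun α => α) || ((q.all fun α => !α) ||
    (List.range M.length).any fun a => (List.range M.length).any fun b =>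
      entry M a b && satisfiable (clash (entry M) M.length a b) M.length q)

namespace PolyTime

variable {δ : Type} [Coded δ]

lemma neg {l : δ → ℕ × Bool} (hl : PolyTime l) : PolyTime fun d => neg (l d) :=
  hl.fst.pair hl.snd.not

lemma lits {n : δ → ℕ} (hn : PolyTime n) : PolyTime fun d => lits (n d) := by
  have key : ∀ l : List ℕ, l.foldl (fun acc i => (i, false) :: (i, true) :: acc) [] =
      l.reverse.flatMap fun i => [(i, false), (i, true)] := by
    intro l
    rw [← List.foldr_reverse]
    generalize l.reverse = l
    induction l with
    | nil => rfl
    | cons x l ih => rw [List.foldr_cons, ih, List.flatMap_cons]; rfl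
  have hsize : ∀ l : List ℕ,
      size (l.flatMap fun i => [(i, false), (i, true)]) ≤ 12 * size l := by
    intro l
    induction l with
    | nil => simp
    | cons x l ih =>
      have h1 := size_bool_le true
      have h2 := size_bool_le false
      have h3 := size_nat x
      simp only [List.flatMap_cons, List.cons_append, List.nil_append, size_cons, size_prod]
      omega
  obtain ⟨p, hp⟩ := hn.range.exists_size_le
  refine (PolyTime.foldl (i := fun _ => []) (g := fun _ acc i => (i, false) :: (i, true) :: acc)
    hn.range.reverse (const []) ((snd'.pair (const false)).cons ((snd'.pair (const true)).cons
      fst'.snd)) (12 * p) fun d m h => ?_).congr fun d => by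
        rw [key, List.reverse_reverse]
        rfl
  rw [key]
  have h1 := hsize m.reverse
  have h2 := size_le_of_sublist h.sublist
  have h3 := hp d
  rw [size_reverse] at h1 h2
  simp only [Polynomial.eval_mul, Polynomial.eval_ofNat]
  omega

section Clauses

variable {n : δ → ℕ} {c : δ → ℕ × Bool → ℕ × Bool → Bool} {S : δ → List (ℕ × Bool)}
  (hc : PolyTime fun x : (δ × (ℕ × Bool)) × (ℕ × Bool) => c x.1.1 x.1.2 x.2)
include hc

lemma propagate (hn : PolyTime n) (hS : PolyTime S) :
    PolyTime fun d => propagate (c d) (n d) (S d) :=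
  hn.lits.filter <| (hS.comp fst').any <| (beq_literal fst'.snd snd').or <|
    hc.comp ((fst'.fst.pair snd').pair fst'.snd.neg)

lemma closure (hn : PolyTime n) (hS : PolyTime S) :
    PolyTime fun d => closure (c d) (n d) (S d) := by
  refine propagate hc hn (propagate hc hn ?_)
  obtain ⟨p, hp⟩ := hn.lits.exists_size_le
  obtain ⟨r, hr⟩ := hS.exists_size_le
  refine PolyTime.foldl (g := fun d T _ => MonoHalf.propagate (c d) (n d) T) hn.lits hS
    (propagate (c := fun x : (δ × List (ℕ × Bool)) × (ℕ × Bool) => c x.1.1)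
      (hc.comp ((fst'.fst.fst.fst.pair fst'.snd).pair snd')) (hn.comp fst'.fst) fst'.snd) (p + r)
    fun d m _ => ?_
  rw [Polynomial.eval_add]
  rcases m.eq_nil_or_concat with rfl | ⟨m, x, rfl⟩
  · exact (hr d).trans (Nat.le_add_left _ _)
  · rw [List.concat_eq_append, List.foldl_append]
    exact ((size_le_of_sublist List.filter_sublist).trans (hp d)).trans (Nat.le_add_right _ _)

lemma consistent (hn : PolyTime n) (hS : PolyTime S) :
    PolyTime fun d => consistent (c d) (n d) (S d) :=
  (closure hc hn hS).all <| ((closure hc hn hS).comp fst').all <|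
    (PolyTime.or (hc.comp ((fst'.fst.pair fst'.snd).pair snd'))
      (beq_literal snd' fst'.snd.neg)).not

lemma satisfiable {q : δ → List Bool} (hn : PolyTime n) (hq : PolyTime q) :
    PolyTime fun d => satisfiable (c d) (n d) (q d) := by
  have hprefix : PolyTime fun d => prefixLits (n d) (q d) :=
    hn.lits.filter <| beq_bool ((hq.comp fst').getD snd'.fst snd'.snd.not) snd'.snd
  have hc' : PolyTime fun x : ((δ × ℕ) × (ℕ × Bool)) × (ℕ × Bool) => c x.1.1.1 x.1.2 x.2 :=
    hc.comp ((fst'.fst.fst.pair fst'.snd).pair snd')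
  have single : ∀ α : Bool, PolyTime fun x : δ × ℕ =>
      MonoHalf.consistent (c x.1) (n x.1) [(x.2, α)] := fun α =>
    consistent (c := fun x : δ × ℕ => c x.1) hc' (hn.comp fst')
      ((snd'.pair (const α)).cons (const []))
  exact (consistent hc hn hprefix).and (hn.range.all ((single false).or (single true)))

end Clauses

section Graph

variable {M : δ → List (List Bool)} {i j a b n : δ → ℕ} {l l' : δ → ℕ × Bool}
  (hM : PolyTime M)
include hM

lemma entry (hi : PolyTime i) (hj : PolyTime j) : PolyTime fun d => entry (M d) (i d) (j d) :=
  (hM.getD hi (const [])).getD hj (const false)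

lemma trigger (hb : PolyTime b) (hi : PolyTime i) (hl : PolyTime l) :
    PolyTime fun d => trigger (MonoHalf.entry (M d)) (b d) (i d) (l d) :=
  ((hM.entry hi hb).and ((hl.fst.beq_nat hi).and hl.snd)).or
    ((hM.entry hi hb).not.and ((hM.entry hi hl.fst).and hl.snd.not))

lemma halfClash (hn : PolyTime n) (ha : PolyTime a) (hb : PolyTime b) (hl : PolyTime l)
    (hl' : PolyTime l') : PolyTime fun d =>
      halfClash (MonoHalf.entry (M d)) (n d) (a d) (b d) (l d) (l' d) := by
  have up : ∀ {β : Type} [Coded β] {f : δ → β}, PolyTime f →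
      PolyTime fun x : (δ × ℕ) × ℕ => f x.1.1 := fun hf => hf.comp fst'.fst
  have hx : PolyTime fun x : (δ × ℕ) × ℕ => x.1.2 := fst'.snd
  have hx' : PolyTime fun x : (δ × ℕ) × ℕ => x.2 := snd'
  exact ((hl.fst.beq_nat ha).and ((hl'.fst.beq_nat ha).and (hl.snd.not.and hl'.snd.not))).or <|
    (hl.snd.and (hl'.snd.not.and ((hM.entry hl.fst hl'.fst).and
      ((hl.fst.beq_nat ha).not.and (hM.entry hl.fst ha).not)))).or <|
    hn.range.any <| (hn.range.comp fst').any <|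
      (hx.beq_nat hx').not.and <| ((up hM).entry hx hx').not.and <|
      ((up hM).entry hx (up ha)).and <| ((up hM).entry hx' (up ha)).and <|
      (hx.beq_nat (up hb)).not.and <| (hx'.beq_nat (up hb)).not.and <|
      ((up hM).trigger (up hb) hx (up hl)).and ((up hM).trigger (up hb) hx' (up hl'))

lemma clash (hn : PolyTime n) (ha : PolyTime a) (hb : PolyTime b) (hl : PolyTime l)
    (hl' : PolyTime l') : PolyTime fun d =>
      clash (MonoHalf.entry (M d)) (n d) (a d) (b d) (l d) (l' d) :=
  ((hM.halfClash hn ha hb hl hl').or (hM.halfClash hn hb ha hl.neg hl'.neg)).or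
    ((hM.halfClash hn ha hb hl' hl).or (hM.halfClash hn hb ha hl'.neg hl.neg))

lemma extendable {q : δ → List Bool} (hq : PolyTime q) :
    PolyTime fun d => extendable (M d) (q d) := by
  have hn := hM.length
  refine (hq.all snd').or <| (hq.all snd'.not).or <| hn.range.any <| (hn.range.comp fst').any <|
    ((hM.comp fst'.fst).entry fst'.snd snd').and ?_
  exact satisfiable
    (c := fun x : (δ × ℕ) × ℕ =>
      MonoHalf.clash (MonoHalf.entry (M x.1.1)) (M x.1.1).length x.1.2 x.2)
    ((hM.comp fst'.fst.fst.fst).clash (hn.comp fst'.fst.fst.fst) fst'.fst.fst.snd fst'.fst.snd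
      fst'.snd snd') (hn.comp fst'.fst) (hq.comp fst'.fst)

end Graph

end PolyTime

/-! ### The enumeration algorithm -/

/-- Puts the extension of `q` by `α` onto the list `acc` if it is extendable to a halfspace. -/
def push (M : List (List Bool)) (α : Bool) (acc : List (List Bool)) (q : List Bool) :
    List (List Bool) :=
  if extendable M (q ++ [α]) then (q ++ [α]) :: acc else acc

/-- All extendable one-bit extensions of the members of `L`. -/
def extensions (M : List (List Bool)) (L : List (List Bool)) : List (List Bool) :=
  L.foldl (fun acc q => push M true (push M false acc q) q) []

/-- The extendable characteristic vectors of length `k`. -/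
def level (M : List (List Bool)) (k : ℕ) : List (List Bool) := (extensions M)^[k] [[]]

/-- The test and the vector that `push` needs, in a form to be computed by a subprogram. -/
def pushData (α : Bool) (x : List (List Bool) × List Bool) : Bool × List Bool :=
  (extendable x.1 (x.2 ++ [α]), x.2 ++ [α])

lemma PolyTime.pushData (α : Bool) : PolyTime (pushData α) :=
  have h := snd'.append ((const α).cons (const []))
  (fst'.extendable h).pair h

namespace Program

/-- Performs `push`: the matrix is in `X₀`, the vector is the head of `X₂`, the list is in `X₄`.
The last assignment does nothing. -/
def push (c : Program) : Program :=
  .seq (c.call (.cons (.var 0) (.hd (.var 2))))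
    (.ite (.hd (.var 1)) (.assign 4 (.cons (.tl (.var 1)) (.var 4))) (.assign 4 (.var 4)))

/-- One round of the enumeration, which takes the list in `X₂` to the list in `X₄`. -/
def round (c₀ c₁ : Program) : Program :=
  .seq (.assign 4 .nil) (.loop (.var 2) (.seq c₀.push (.seq c₁.push (.assign 2 (.tl (.var 2))))))

/-- The enumeration algorithm; `X₆` counts the rounds by taking a copy of the matrix apart. -/
def enumerate (c₀ c₁ : Program) : Program :=
  .seq (.assign 6 (.var 0)) (.seq (.assign 2 (.cons .nil .nil)) (.seq
    (.loop (.var 6) (.seq (c₀.round c₁) (.seq (.assign 2 (.var 4)) (.assign 6 (.tl (.var 6))))))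
    (.assign 0 (.var 2))))

end Program

section Correctness

variable {M : List (List Bool)} {c c₀ c₁ : Program} {p p₀ p₁ : Polynomial ℕ}

lemma ComputesIn.push {α : Bool} (hc : ComputesIn c p (pushData α)) {s : Store} {q : List Bool}
    {L acc : List (List Bool)} {B : ℕ} (h0 : s 0 = code M) (h2 : s 2 = code (q :: L))
    (h4 : s 4 = code acc) (hB : size (M, q) ≤ B) :
    Runs c.push s (p.eval B + 15) fun s' => s' 0 = code M ∧ s' 2 = code (q :: L) ∧
      s' 4 = code (push M α acc q) ∧ s' 6 = s 6 := by
  refine Runs.mono (.seq ((hc.call (a := (M, q)) (by simp [Expr.val, h0, h2, Data.hd])).mono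
    le_rfl ?_)) (T₁ := 4 + 1 + p.eval (size (M, q)) + (2 + 1 + 5)) ?_ fun _ h => h
  · rintro s₁ ⟨h5, h6⟩
    have e0 := (h6 0).trans h0
    have e2 := (h6 1).trans h2
    have e4 := (h6 2).trans h4
    have e6 := h6 3
    norm_num at e0 e2 e4 e6
    refine .ite (fun h => .assign ?_) (fun h => Runs.mono (.assign (Q := fun s' =>
      s' 0 = code M ∧ s' 2 = code (q :: L) ∧ s' 4 = code (MonoHalf.push M α acc q) ∧
        s' 6 = s 6) ?_) (by simp [Expr.cost]) fun _ h => h)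
    · have hext : extendable M (q ++ [α]) = true := by
        by_contra hext
        simp only [Bool.not_eq_true] at hext
        simp [Expr.val, h5, pushData, hext, Data.hd] at h
      simp [Expr.val, e0, e2, e4, e6, h5, pushData, MonoHalf.push, hext, Data.tl]
    · have hext : extendable M (q ++ [α]) = false := by
        by_contra hext
        simp only [Bool.not_eq_false] at hext
        simp [Expr.val, h5, pushData, hext, Data.hd] at h
      simp [Expr.val, e0, e2, e4, e6, MonoHalf.push, hext]
  · have := eval_mono p hB
    omega

variable (h₀ : ComputesIn c₀ p₀ (pushData false)) (h₁ : ComputesIn c₁ p₁ (pushData true))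
include h₀ h₁

lemma runs_round {L : List (List Bool)} {B : ℕ} (hB : ∀ q ∈ L, size (M, q) ≤ B) {s : Store}
    (h0 : s 0 = code M) (h2 : s 2 = code L) :
    Runs (c₀.round c₁) s (L.length * (p₀.eval B + p₁.eval B + 40) + 5) fun s' =>
      s' 0 = code M ∧ s' 4 = code (extensions M L) ∧ s' 6 = s 6 := by
  let I : List (List Bool) → Store → Prop := fun R s' => s' 0 = code M ∧ s' 2 = code R ∧
    s' 6 = s 6 ∧ ∃ P, L = P ++ R ∧
      s' 4 = code (P.foldl (fun acc q => push M true (push M false acc q) q) [])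
  have hbody : ∀ q R s', I (q :: R) s' → Runs (.seq c₀.push (.seq c₁.push
      (.assign 2 (.tl (.var 2))))) s' (p₀.eval B + p₁.eval B + 38) (I R) := by
    rintro q R s' ⟨h0, h2, h6, P, hP, h4⟩
    have hq := hB q (by simp [hP])
    refine Runs.mono (.seq ((h₀.push h0 h2 h4 hq).mono le_rfl ?_))
      (T₁ := p₀.eval B + 15 + (p₁.eval B + 15 + (2 + 1))) (by omega) fun _ h => h
    rintro s₁ ⟨e0, e2, e4, e6⟩
    refine .seq ((h₁.push e0 e2 e4 hq).mono le_rfl ?_)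
    rintro s₂ ⟨f0, f2, f4, f6⟩
    refine .assign ⟨?_, ?_, ?_, P ++ [q], by simp [hP], ?_⟩
    · simpa using f0
    · simp [Expr.val, f2, Data.tl]
    · simpa [f6, e6] using h6
    · simp [f4]
  refine Runs.mono (.seq (.assign ((Runs.loop I (fun _ _ h => h.2.1) hbody L _ ?_).mono
    le_rfl ?_))) (T₁ := 1 + 1 + (L.length * (p₀.eval B + p₁.eval B + 38 + 2) + 2)) ?_ fun _ h => h
  · exact ⟨by simpa using h0, by simpa using h2, by simp, [], rfl, by simp [Expr.val]⟩
  · rintro s' ⟨f0, -, f6, P, hP, f4⟩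
    rw [List.append_nil] at hP
    exact ⟨f0, by rw [f4, hP]; rfl, f6⟩
  · have : p₀.eval B + p₁.eval B + 38 + 2 = p₀.eval B + p₁.eval B + 40 := by omega
    rw [this]
    omega

lemma runs_enumerate {B N : ℕ} (hN : ∀ k < M.length, (level M k).length ≤ N)
    (hB : ∀ k < M.length, ∀ q ∈ level M k, size (M, q) ≤ B) {s : Store} (h0 : s 0 = code M) :
    Runs (c₀.enumerate c₁) s
      (M.length * (N * (p₀.eval B + p₁.eval B + 40) + 15) + 20) fun s' =>
        s' 0 = code (level M M.length) := by
  set T := p₀.eval B + p₁.eval B + 40 with hT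
  let I : List (List Bool) → Store → Prop := fun R s' => s' 0 = code M ∧ s' 6 = code R ∧
    ∃ k, k + R.length = M.length ∧ s' 2 = code (level M k)
  have hbody : ∀ r R s', I (r :: R) s' → Runs (.seq (c₀.round c₁) (.seq (.assign 2 (.var 4))
      (.assign 6 (.tl (.var 6))))) s' (N * T + 10) (I R) := by
    rintro r R s' ⟨h0, h6, k, hk, h2⟩
    rw [List.length_cons] at hk
    refine Runs.mono (.seq ((runs_round h₀ h₁ (hB k (by omega)) h0 h2).mono le_rfl ?_))
      (T₁ := (level M k).length * T + 5 + (1 + 1 + (2 + 1))) ?_ fun _ h => h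
    · rintro s₁ ⟨e0, e4, e6⟩
      refine .seq (.assign (.assign ⟨?_, ?_, k + 1, by omega, ?_⟩))
      · simpa using e0
      · simp [Expr.val, e6, h6, Data.tl]
      · simp [Expr.val, e4, level, Function.iterate_succ_apply']
    · have : (level M k).length * T ≤ N * T := Nat.mul_le_mul_right _ (hN k (by omega))
      omega
  refine Runs.mono (.seq (.assign (.seq (.assign (.seq
    ((Runs.loop I (fun _ _ h => h.2.1) hbody M _ ?_).mono le_rfl ?_))))))
    (T₁ := 1 + 1 + (3 + 1 + (M.length * (N * T + 10 + 2) + 2 + (1 + 1)))) ?_ fun _ h => h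
  · exact ⟨by simpa using h0, by simpa [Expr.val] using h0, 0, by simp,
      by simp [Expr.val, level]⟩
  · rintro s' ⟨-, -, k, hk, f2⟩
    refine .assign ?_
    rw [List.length_nil, add_zero] at hk
    simp [Expr.val, f2, hk]
  · have : M.length * (N * T + 10 + 2) ≤ M.length * (N * T + 15) :=
      Nat.mul_le_mul_left _ (by omega)
    omega

end Correctness

lemma extensions_eq (M L : List (List Bool)) : extensions M L =
    ((L.flatMap fun q => [q ++ [false], q ++ [true]]).filter (extendable M)).reverse := by
  have key : ∀ acc, L.foldl (fun acc q => push M true (push M false acc q) q) acc =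
      ((L.flatMap fun q => [q ++ [false], q ++ [true]]).filter (extendable M)).reverse ++ acc := by
    induction L with
    | nil => simp
    | cons q L ih =>
      intro acc
      rw [List.foldl_cons, ih, List.flatMap_cons, List.filter_append, List.reverse_append,
        List.append_assoc]
      congr 1
      unfold push
      cases h₁ : extendable M (q ++ [false]) <;> cases h₂ : extendable M (q ++ [true]) <;>
        simp [h₁, h₂]
  simpa [extensions] using key []

lemma mem_extensions {M L : List (List Bool)} {q : List Bool} : q ∈ extensions M L ↔
    ∃ r ∈ L, ∃ α, q = r ++ [α] ∧ extendable M q = true := by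
  simp only [extensions_eq, List.mem_reverse, List.mem_filter, List.mem_flatMap, List.mem_cons,
    List.not_mem_nil, or_false, Bool.exists_bool]
  grind

lemma nodup_extensions {M L : List (List Bool)} (hL : L.Nodup) : (extensions M L).Nodup := by
  rw [extensions_eq, List.nodup_reverse]
  refine List.Nodup.filter _ (List.nodup_flatMap.2 ⟨fun q _ => by simp, hL.imp ?_⟩)
  intro q r hqr
  simp only [Function.onFun, List.disjoint_left, List.mem_cons, List.not_mem_nil, or_false]
  rintro x (rfl | rfl) (h | h) <;> exact hqr (List.append_inj_left' h rfl)

/-! ### Adjacency matrices and characteristic vectors -/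

section Vectors

variable {n : ℕ} {G : SimpleGraph (Fin n)}

open Classical in
/-- The characteristic vector of a set of vertices. -/
noncomputable def charVec (H : Finset (Fin n)) : List Bool := List.ofFn fun i => decide (i ∈ H)

open Classical in
/-- The adjacency matrix of a graph. -/
noncomputable def matrix (G : SimpleGraph (Fin n)) : List (List Bool) :=
  List.ofFn fun i => List.ofFn fun j => decide (G.Adj i j)

lemma encodeSet_eq (H : Finset (Fin n)) : encodeSet H = code (charVec H) := by
  simp only [encodeSet, charVec, code, List.map_ofFn]
  rfl

lemma encodeGraph_eq (G : SimpleGraph (Fin n)) : encodeGraph G = code (matrix G) := by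
  simp only [encodeGraph, matrix, code, List.map_ofFn]
  congr 2
  funext i
  simp only [Function.comp_apply, List.map_ofFn]
  rfl

@[simp]
lemma length_matrix : (matrix G).length = n := by
  simp [matrix]

@[simp]
lemma length_charVec (H : Finset (Fin n)) : (charVec H).length = n := by
  simp [charVec]

lemma entry_matrix {i j : ℕ} :
    entry (matrix G) i j = true ↔ ∃ (hi : i < n) (hj : j < n), G.Adj ⟨i, hi⟩ ⟨j, hj⟩ := by
  by_cases hi : i < n
  · by_cases hj : j < n <;> simp [entry, matrix, hi, hj, List.getD_eq_getElem?_getD]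
  · simp [entry, matrix, hi, List.getD_eq_getElem?_getD]

lemma prefix_charVec_iff {q : List Bool} {H : Finset (Fin n)} (hq : q.length ≤ n) :
    q <+: charVec H ↔ ∀ i (hi : i < n), i < q.length → (q[i]? = some true ↔ ⟨i, hi⟩ ∈ H) := by
  rw [List.prefix_iff_getElem?]
  constructor
  · intro h i hi hiq
    have := h i hiq
    simp only [charVec, List.getElem?_ofFn, hi, dite_true, Option.some.injEq] at this
    simp [hiq, ← this]
  · intro h i hiq
    have := h i (by omega) hiq
    simp only [charVec, List.getElem?_ofFn, (by omega : i < n), dite_true, Option.some.injEq]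
    rw [Bool.eq_iff_iff, decide_eq_true_iff, ← this]
    simp [hiq]

lemma cutClique_iff {σ : ℕ → Bool} {H : Set (Fin n)}
    (h : ∀ i (hi : i < n), σ i = true ↔ ⟨i, hi⟩ ∈ H) :
    CutClique (entry (matrix G)) σ ↔ BoundaryClique G H := by
  have h' : ∀ i (hi : i < n), σ i = false ↔ ⟨i, hi⟩ ∉ H := fun i hi => by
    rw [← h, Bool.not_eq_true]
  constructor
  · intro hc x x' y y' hx hx' hy hy' hxy hxy' hne
    obtain ⟨_, _, hadj⟩ := entry_matrix.1 (hc x x' y y' ((h _ x.2).2 hx) ((h _ x'.2).2 hx')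
      ((h' _ y.2).2 hy) ((h' _ y'.2).2 hy') (entry_matrix.2 ⟨x.2, y.2, hxy⟩)
      (entry_matrix.2 ⟨x'.2, y'.2, hxy'⟩) (fun e => hne (Fin.ext e)))
    exact hadj
  · intro hc x x' y y' hx hx' hy hy' hxy hxy' hne
    obtain ⟨h1, h2, hxy⟩ := entry_matrix.1 hxy
    obtain ⟨h3, h4, hxy'⟩ := entry_matrix.1 hxy'
    exact entry_matrix.2 ⟨h1, h3, hc ((h _ _).1 hx) ((h _ _).1 hx') ((h' _ _).1 hy)
      ((h' _ _).1 hy') hxy hxy' (fun e => hne (congrArg Fin.val e))⟩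

lemma empty_mem_mHalfspaces {V : Type} [Fintype V] (G : SimpleGraph V) : ∅ ∈ mHalfspaces G := by
  rw [mem_mHalfspaces]
  refine ⟨fun u hu => by simp at hu, fun u _ v _ w _ => by simp⟩

lemma univ_mem_mHalfspaces {V : Type} [Fintype V] (G : SimpleGraph V) :
    Finset.univ ∈ mHalfspaces G := by
  rw [mem_mHalfspaces]
  refine ⟨fun u _ v _ w _ => by simp, fun u hu => by simp at hu⟩

lemma extendable_iff (hG : G.Connected) {q : List Bool} (hq : q.length ≤ n) :
    extendable (matrix G) q = true ↔ ∃ H ∈ mHalfspaces G, q <+: charVec H := by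
  have hlt : ∀ i j, entry (matrix G) i j = true → i < n ∧ j < n := fun i j h =>
    (entry_matrix.1 h).elim fun hi h => ⟨hi, h.elim fun hj _ => hj⟩
  have hsymm : ∀ i j, entry (matrix G) i j = entry (matrix G) j i := fun i j => by
    rw [Bool.eq_iff_iff, entry_matrix, entry_matrix]
    exact ⟨fun ⟨hi, hj, h⟩ => ⟨hj, hi, h.symm⟩, fun ⟨hi, hj, h⟩ => ⟨hj, hi, h.symm⟩⟩
  simp only [extendable, Bool.or_eq_true, List.all_eq_true, List.any_eq_true, Bool.and_eq_true,
    List.mem_range, length_matrix]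
  constructor
  · rintro (h | h | ⟨a, ha, b, hb, hab, hsat⟩)
    · refine ⟨_, univ_mem_mHalfspaces G, (prefix_charVec_iff hq).2 fun i hi hiq => ?_⟩
      simpa [hiq] using h _ (List.getElem_mem hiq)
    · refine ⟨_, empty_mem_mHalfspaces G, (prefix_charVec_iff hq).2 fun i hi hiq => ?_⟩
      simpa [hiq] using h _ (List.getElem_mem hiq)
    · obtain ⟨σ, hσ, hqσ⟩ := (satisfiable_iff (clash_symm _ _ _ _) hq).1 hsat
      obtain ⟨-, -, hc, hc'⟩ := (clash_eq_false_iff hlt hsymm hab).1 hσ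
      refine ⟨Finset.univ.filter fun i => σ i = true, ?_, (prefix_charVec_iff hq).2 ?_⟩
      · rw [mem_mHalfspaces, isMHalfspace_iff hG]
        exact ⟨(cutClique_iff fun i hi => by simp).1 hc,
          (cutClique_iff fun i hi => by simp).1 hc'⟩
      · intro i hi hiq
        simp [hqσ i hiq]
  · rintro ⟨H, hH, hqH⟩
    rw [prefix_charVec_iff hq] at hqH
    by_cases hne : H.Nonempty
    · by_cases hne' : Hᶜ.Nonempty
      · right
        right
        rw [mem_mHalfspaces] at hH
        obtain ⟨a, b, hab, ht⟩ := exists_tight hG hH (by simpa using hne)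
          (by rw [← Finset.coe_compl]; exact Finset.coe_nonempty.2 hne')
        have hab' : entry (matrix G) a b = true := entry_matrix.2 ⟨a.2, b.2, hab⟩
        refine ⟨a, a.2, b, b.2, hab', (satisfiable_iff (clash_symm _ _ _ _) hq).2 ?_⟩
        classical
        let σ : ℕ → Bool := fun i => if h : i < n then decide (⟨i, h⟩ ∈ H) else false
        have hσ : ∀ i (hi : i < n), σ i = true ↔ ⟨i, hi⟩ ∈ (H : Set (Fin n)) := fun i hi => by
          simp [σ, hi]
        refine ⟨σ, (clash_eq_false_iff hlt hsymm hab').2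
          ⟨(hσ a a.2).2 ht.left_mem, ?_, (cutClique_iff hσ).2 ht.clique,
            (cutClique_iff fun i hi => ?_).2 ht.clique_compl⟩, fun i hi => ?_⟩
        · rw [← Bool.not_eq_true, hσ b b.2]
          exact ht.right_notMem
        · rw [Set.mem_compl_iff, ← hσ i hi]
          simp
        · have h1 := hqH i (by omega) hi
          have h2 := hσ i (by omega)
          rw [List.getElem?_eq_getElem hi] at h1 ⊢
          rw [Finset.mem_coe, ← h1, Option.some.injEq] at h2
          rw [Option.some.injEq, Bool.eq_iff_iff, h2]
      · left
        intro α hα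
        obtain ⟨i, hi, rfl⟩ := List.mem_iff_getElem.1 hα
        have h1 := hqH i (by omega) hi
        rw [List.getElem?_eq_getElem hi, Option.some.injEq] at h1
        rw [h1]
        by_contra hc
        exact hne' ⟨_, Finset.mem_compl.2 hc⟩
    · right
      left
      intro α hα
      obtain ⟨i, hi, rfl⟩ := List.mem_iff_getElem.1 hα
      have h1 := hqH i (by omega) hi
      rw [List.getElem?_eq_getElem hi, Option.some.injEq] at h1
      rw [Bool.not_eq_true', ← Bool.not_eq_true, h1]
      exact fun h => hne ⟨_, h⟩

/-- After `k` rounds the list holds the restrictions of the halfspaces to the first `k` vertices. -/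
lemma mem_level (hG : G.Connected) {k : ℕ} (hk : k ≤ n) {q : List Bool} :
    q ∈ level (matrix G) k ↔ q.length = k ∧ ∃ H ∈ mHalfspaces G, q <+: charVec H := by
  induction k generalizing q with
  | zero =>
    simp only [level, Function.iterate_zero, id_eq, List.mem_singleton, List.length_eq_zero_iff]
    constructor
    · rintro rfl
      exact ⟨rfl, ∅, empty_mem_mHalfspaces G, List.nil_prefix⟩
    · exact fun h => h.1
  | succ k ih =>
    rw [level, Function.iterate_succ_apply']
    change q ∈ extensions _ (level _ k) ↔ _
    rw [mem_extensions]
    constructor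
    · rintro ⟨r, hr, α, rfl, hext⟩
      have hr := ((ih (by omega)).1 hr).1
      have hlen : (r ++ [α]).length = k + 1 := by simp [hr]
      exact ⟨hlen, (extendable_iff hG (by omega)).1 hext⟩
    · rintro ⟨hlen, H, hH, hpre⟩
      rcases q.eq_nil_or_concat with rfl | ⟨r, α, rfl⟩
      · simp at hlen
      · rw [List.concat_eq_append] at *
        refine ⟨r, (ih (by omega)).2 ⟨by simpa using hlen, H, hH,
          (List.prefix_append _ _).trans hpre⟩, α, rfl, ?_⟩
        exact (extendable_iff hG (by omega)).2 ⟨H, hH, hpre⟩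

lemma nodup_level (M : List (List Bool)) (k : ℕ) : (level M k).Nodup := by
  induction k with
  | zero => simp [level]
  | succ k ih =>
    rw [level, Function.iterate_succ_apply']
    exact nodup_extensions ih

lemma length_level_le (hG : G.Connected) {k : ℕ} (hk : k ≤ n) :
    (level (matrix G) k).length ≤ (mHalfspaces G).card := by
  rw [← List.toFinset_card_of_nodup (nodup_level _ _)]
  refine (Finset.card_le_card (t := (mHalfspaces G).image fun H => (charVec H).take k) ?_).trans
    Finset.card_image_le
  intro q hq
  rw [List.mem_toFinset, mem_level hG hk] at hq
  obtain ⟨rfl, H, hH, hpre⟩ := hq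
  exact Finset.mem_image.2 ⟨H, hH, (List.prefix_iff_eq_take.1 hpre).symm⟩

lemma mem_level_self (hG : G.Connected) {q : List Bool} :
    q ∈ level (matrix G) n ↔ ∃ H ∈ mHalfspaces G, charVec H = q := by
  rw [mem_level hG le_rfl]
  constructor
  · rintro ⟨hlen, H, hH, hpre⟩
    exact ⟨H, hH, (hpre.eq_of_length (by simpa using hlen)).symm⟩
  · rintro ⟨H, hH, rfl⟩
    exact ⟨length_charVec H, H, hH, List.prefix_refl _⟩

lemma size_bits_le (q : List Bool) : size q ≤ 4 * q.length + 1 := by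
  induction q with
  | nil => simp
  | cons α q ih =>
    have := size_bool_le α
    simp only [size_cons, List.length_cons]
    omega

lemma size_rows_le {M : List (List Bool)} {m : ℕ} (h : ∀ r ∈ M, r.length ≤ m) :
    size M ≤ M.length * (4 * m + 2) + 1 := by
  induction M with
  | nil => simp
  | cons r M ih =>
    have h1 := ih fun r hr => h r (List.mem_cons_of_mem _ hr)
    have h2 := h r List.mem_cons_self
    have h3 := size_bits_le r
    simp only [size_cons, List.length_cons]
    nlinarith

lemma size_matrix_le : size (matrix G) ≤ n * (4 * n + 2) + 1 := by
  refine (size_rows_le (m := n) fun r hr => ?_).trans (by simp)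
  obtain ⟨i, rfl⟩ := (List.mem_ofFn' _ _).1 hr
  simp

/-- The output of the enumeration lists every halfspace once. -/
lemma enumerates_of_computes (hG : G.Connected) {c : Program} {t : ℕ}
    (h : Computes c (code (matrix G)) t (code (level (matrix G) n))) : Enumerates c G t := by
  classical
  let set : List Bool → Finset (Fin n) := fun q => Finset.univ.filter fun i => q[i.1]? = some true
  have hset : ∀ H : Finset (Fin n), set (charVec H) = H := fun H => by
    ext i
    simp [set, charVec]
  refine ⟨(level (matrix G) n).map set, ?_, fun H => ?_, ?_⟩
  · refine (nodup_level _ _).map_on fun q hq r hr hqr => ?_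
    obtain ⟨H, -, rfl⟩ := (mem_level_self hG).1 hq
    obtain ⟨K, -, rfl⟩ := (mem_level_self hG).1 hr
    rw [hset, hset] at hqr
    rw [hqr]
  · rw [List.mem_map]
    constructor
    · rintro ⟨q, hq, rfl⟩
      obtain ⟨H, hH, rfl⟩ := (mem_level_self hG).1 hq
      rwa [hset]
    · exact fun hH => ⟨_, (mem_level_self hG).2 ⟨H, hH, rfl⟩, hset H⟩
  · rw [encodeGraph_eq, List.map_map]
    have : (level (matrix G) n).map (encodeSet ∘ set) = (level (matrix G) n).map code := by
      refine List.map_congr_left fun q hq => ?_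
      obtain ⟨H, -, rfl⟩ := (mem_level_self hG).1 hq
      rw [Function.comp_apply, hset, encodeSet_eq]
    rw [this]
    exact h

lemma ncard_edgeSet_le (G : SimpleGraph (Fin n)) : G.edgeSet.ncard ≤ n * n := by
  classical
  have h := G.card_edgeFinset_le_card_choose_two
  rw [← SimpleGraph.coe_edgeFinset, Set.ncard_coe_finset]
  refine h.trans ((Nat.choose_le_pow _ _).trans ?_)
  rw [Fintype.card_fin, sq]

end Vectors

end MonoHalf

theorem mainTheorem6 :
    (∀ (V : Type*) [Fintype V] [DecidableEq V] (G : SimpleGraph V), G.Connected →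
      (MonoHalf.mHalfspaces G).card ≤
        G.edgeSet.ncard * 2 ^ (MonoHalf.mHalfspaces G).vcDim + 2) ∧
    ∃ (c : MonoHalf.Program) (p : Polynomial ℕ),
      ∀ (n : ℕ) (G : SimpleGraph (Fin n)), G.Connected →
        ∃ t : ℕ, MonoHalf.Enumerates c G t ∧
          t ≤ (MonoHalf.mHalfspaces G).card * p.eval n ∧
          t ≤ 2 ^ (MonoHalf.mHalfspaces G).vcDim * p.eval n := by
  refine ⟨fun V _ _ G hG => MonoHalf.card_mHalfspaces_le hG, ?_⟩
  obtain ⟨c₀, p₀, h₀⟩ := MonoHalf.PolyTime.pushData false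
  obtain ⟨c₁, p₁, h₁⟩ := MonoHalf.PolyTime.pushData true
  -- `B` bounds the size of an adjacency matrix together with a vector, `P` the time per halfspace
  let B : Polynomial ℕ := Polynomial.X * (4 * Polynomial.X + 2) + 4 * Polynomial.X + 3
  let P : Polynomial ℕ := Polynomial.X * (p₀.comp B + p₁.comp B + 55) + 20
  refine ⟨c₀.enumerate c₁, P * (Polynomial.X * Polynomial.X + 2), fun n G hG => ?_⟩
  set h := (MonoHalf.mHalfspaces G).card with hh
  have hpos : 1 ≤ h := Finset.card_pos.2 ⟨_, MonoHalf.empty_mem_mHalfspaces G⟩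
  have hlen : (MonoHalf.matrix G).length = n := MonoHalf.length_matrix
  obtain ⟨t, s, ht, hs, hout⟩ := MonoHalf.runs_enumerate (M := MonoHalf.matrix G) h₀ h₁
    (N := h) (B := B.eval n)
    (fun k hk => MonoHalf.length_level_le hG (by omega))
    (fun k hk q hq => by
      have h1 := (MonoHalf.mem_level hG (by omega)).1 hq
      have h2 := MonoHalf.size_bits_le q
      have h3 := MonoHalf.size_matrix_le (G := G)
      simp only [MonoHalf.size_prod, B, Polynomial.eval_add, Polynomial.eval_mul,
        Polynomial.eval_X, Polynomial.eval_ofNat]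
      omega)
    (s := Function.update (fun _ => MonoHalf.Data.nil) 0 (MonoHalf.Coded.code (MonoHalf.matrix G)))
    (by simp)
  rw [hlen] at ht hout
  have htP : t ≤ h * P.eval n := by
    refine ht.trans ?_
    simp only [P, Polynomial.eval_add, Polynomial.eval_mul, Polynomial.eval_X,
      Polynomial.eval_ofNat, Polynomial.eval_comp]
    generalize Polynomial.eval (Polynomial.eval n B) p₀ = x
    generalize Polynomial.eval (Polynomial.eval n B) p₁ = y
    calc n * (h * (x + y + 40) + 15) + 20
        ≤ n * (h * (x + y + 40) + h * 15) + h * 20 := by gcongr <;> omega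
      _ = h * (n * (x + y + 55) + 20) := by ring
  refine ⟨t, MonoHalf.enumerates_of_computes hG ⟨s, hs, hout⟩, htP.trans ?_, htP.trans ?_⟩
  · gcongr
    simp only [Polynomial.eval_add, Polynomial.eval_mul, Polynomial.eval_X, Polynomial.eval_ofNat]
    exact Nat.le_mul_of_pos_right _ (by omega)
  · have h1 := MonoHalf.card_mHalfspaces_le hG
    have h2 := MonoHalf.ncard_edgeSet_le G
    set e := 2 ^ (MonoHalf.mHalfspaces G).vcDim with he
    have h3 : 1 ≤ e := Nat.one_le_two_pow
    have h4 : h ≤ e * (n * n + 2) := by nlinarith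
    simp only [Polynomial.eval_add, Polynomial.eval_mul, Polynomial.eval_X, Polynomial.eval_ofNat]
    calc h * P.eval n ≤ e * (n * n + 2) * P.eval n := by gcongr
      _ = e * (P.eval n * (n * n + 2)) := by ring
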